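/- Let $n\ge 1$, $\theta\in\mathbb C$, $q=e^{\theta}$, $q^{z}=e^{\theta z}$ for $z\in\mathbb C$, and assume $q^{2k}\ne 1$ for $1\le k\le n$ (for instance, $q\neq 0$ not a root of unity). Let $M$ be the field of meromorphic functions on $\mathbb C^n$, $e_i$ the $i$-th unit vector, $\omega(i)=e_i$, and $(T_\alpha f)(\lambda)=f(\lambda+\alpha)$. Put $$h_0(z)=\frac{q^{-1}-q}{q^{-2z}-1},\qquad h(z)=q-h_0(z)=q\,\frac{q^{-2z}-q^{-2}}{q^{-2z}-1},\qquad g(z)=\frac{(q^{-2z}-q^{-2})(q^{-2z}-q^{2})}{(q^{-2z}-1)^2},$$ let $u_1,\dots,u_n$ be the standard basis of $\mathbb C^n$, with matrix units $E_{ab}$, let $$R(\lambda)=q\sum_a E_{aa}\otimes E_{aa}+\sum_{a<b}E_{aa}\otimes E_{bb}+\sum_{a>b}g(\lambda_a-\lambda_b)E_{aa}\otimes E_{bb}+\sum_{a\ne b}h_0(\lambda_a-\lambda_b)E_{ba}\otimes E_{ab},$$ and let $R^{xy}_{ac}$ be the coefficient of $u_a\otimes u_c$ in $R(\lambda)(u_x\otimes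 u_y)$. The algebra $F=\mathcal F_R(M(n))$ is the unital associative $\mathbb C$-algebra generated by two copies of $M$ (with elements written $\mu_l(f)=f(\lambda)$ and $\mu_r(f)=f(\mu)$) and elements $t_{ij}$, $1\le i,j\le n$, with relations $f_1(\lambda)f_2(\mu)=f_2(\mu)f_1(\lambda)$, $f(\lambda)t_{ij}=t_{ij}(T_{\omega(i)}f)(\lambda)$, $f(\mu)t_{ij}=t_{ij}(T_{\omega(j)}f)(\mu)$ and $$\sum_{x,y}R^{xy}_{ac}(\lambda)\,t_{xb}t_{yd}=\sum_{x,y}R^{bd}_{xy}(\mu)\,t_{cy}t_{ax}\qquad(1\le a,b,c,d\le n).$$ It is bigraded by $f(\lambda),f(\mu)\in F_{00}$, $t_{ij}\in F_{\omega(i)\omega(j)}$. Let $W$ be the unital associative $\mathbb C$-algebra generated by a copy of $M$ and $w_1,\dots,w_n$ with relations $f(\lambda)w_i=w_i(T_{\omega(i)}f)(\lambda)$, $w_i^2=0$, and $w_jw_i=-h(\lambda_j-\lambda_i)w_iw_j$ for $i<j$. Let $V$ be the one generated by a copy of $M$ and $v_1,\dots,v_n$ with relations $f(\lambda)v_i=v_i(T_{\omega(i)}f)(\lambda)$,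 $v_i^2=0$, and $v_iv_j=-h(\lambda_i-\lambda_j)v_jv_i$ for $i<j$. Both are graded by $M$ in degree $0$ and $w_i,v_i$ in degree $\omega(i)$. For $I=\{i_1<\dots<i_r\}\subseteq\{1,\dots,n\}$ put $w_I=w_{i_1}\cdots w_{i_r}$ and $v_I=v_{i_r}\cdots v_{i_1}$. Let $W\tilde\otimes F=\bigoplus_{\alpha,\beta}W_\alpha\otimes_M F_{\alpha\beta}$, the tensor product being taken modulo $fw\otimes a=w\otimes\mu_l(f)a$, and $F\tilde\otimes V=\bigoplus_{\alpha,\beta}F_{\alpha\beta}\otimes_M V_\beta$, modulo $\mu_r(f)a\otimes v=a\otimes fv$. Both are algebras with the componentwise product. **Theorem.** There is a unique $\mathbb C$-algebra homomorphism $R:W\to W\tilde\otimes F$ with $R(f)=1\otimes\mu_r(f)$ for $f\in M$ and $R(w_i)=\sum_j w_j\otimes t_{ji}$ (the right exterior corepresentation), and a unique $\mathbb C$-algebra homomorphism $L:V\to F\tilde\otimes V$ with $L(f)=\mu_l(f)\otimes 1$ and $L(v_i)=\sum_j t_{ij}\otimes v_j$ (the left one). There are unique families $\xi^I_J,\eta^I_J\in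 F$, indexed by the subsets $I,J$ of $\{1,\dots,n\}$ and zero for $\#I\ne\#J$, with $$R(w_J)=\sum_{\#I=\#J}w_I\otimes\xi^I_J,\qquad L(v_I)=\sum_{\#J=\#I}\eta^I_J\otimes v_J$$ for all $J$, respectively all $I$. These families coincide: $\xi^I_J=\eta^I_J$ in $\mathcal F_R(M(n))$ for all $I,J$. In particular $\det=\xi^{\{1,\dots,n\}}_{\{1,\dots,n\}}$ equals $\widetilde{\det}=\eta^{\{1,\dots,n\}}_{\{1,\dots,n\}}$. -/

import Mathlib

open Filter Topology
open scoped TensorProduct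

namespace DynU

/-- `f : ℂⁿ → ℂ` represents a meromorphic function of `n` variables: near every point `z` it is a
quotient `g / h` of two holomorphic functions, where `h` does not vanish identically near `z`.  The
values of `f` on a meagre set (in particular on the poles) are irrelevant. -/
def IsMero {n : ℕ} (f : (Fin n → ℂ) → ℂ) : Prop :=
  ∀ z : Fin n → ℂ, ∃ g h : (Fin n → ℂ) → ℂ, AnalyticAt ℂ g z ∧ AnalyticAt ℂ h z ∧
    (¬ ∀ᶠ x in 𝓝 z, h x = 0) ∧ ∀ᶠ x in 𝓝 z ⊓ residual (Fin n → ℂ), f x * h x = g x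

theorem residual_of_locally {n : ℕ} {p : (Fin n → ℂ) → Prop}
    (h : ∀ z, ∀ᶠ x in 𝓝 z ⊓ residual (Fin n → ℂ), p x) : ∀ᶠ x in residual (Fin n → ℂ), p x := by
  have hL : IsLindelof (Set.univ : Set (Fin n → ℂ)) := isLindelof_univ
  by_contra hp
  have hne : NeBot (residual (Fin n → ℂ) ⊓ 𝓟 {x | ¬ p x}) := by
    rw [inf_principal_neBot_iff]
    intro U hU
    by_contra hcon
    refine hp (mem_of_superset hU fun x hx => ?_)
    by_contra hpx
    exact hcon ⟨x, hx, hpx⟩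
  obtain ⟨z, -, hz⟩ := hL (f := residual (Fin n → ℂ) ⊓ 𝓟 {x | ¬ p x}) (by simp)
  have h1 := h z
  unfold ClusterPt at hz
  rw [← inf_assoc, inf_principal_neBot_iff] at hz
  obtain ⟨x, hx, hx'⟩ := hz _ h1
  exact hx' hx

/-- A holomorphic function that is not identically zero near a point vanishes only on a meagre set
near this point. -/
theorem eventually_ne_of_analyticAt {n : ℕ} {h : (Fin n → ℂ) → ℂ} {z : Fin n → ℂ}
    (ha : AnalyticAt ℂ h z) (h0 : ¬ ∀ᶠ x in 𝓝 z, h x = 0) :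
    ∀ᶠ x in 𝓝 z ⊓ residual (Fin n → ℂ), h x ≠ 0 := by
  obtain ⟨r, hr, hB⟩ := Metric.eventually_nhds_iff_ball.1 ha.eventually_analyticAt
  have hB' : AnalyticOnNhd ℂ h (Metric.ball z r) := fun x hx => hB x hx
  have hpre : IsPreconnected (Metric.ball z r) := (convex_ball z r).isPreconnected
  have hne : ∀ y ∈ Metric.ball z r, ¬ ∀ᶠ x in 𝓝 y, h x = 0 := by
    intro y hy hy0
    have := hB'.eqOn_zero_of_preconnected_of_eventuallyEq_zero hpre hy hy0
    exact h0 (Filter.mem_of_superset (Metric.ball_mem_nhds z hr) fun x hx => this hx)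
  have hopen : IsOpen (Metric.ball z r ∩ {x | h x ≠ 0}) :=
    hB'.continuousOn.isOpen_inter_preimage Metric.isOpen_ball isOpen_ne
  have hD : Metric.ball z r ∩ {x | h x ≠ 0} ∪ (closure (Metric.ball z r))ᶜ ∈
      residual (Fin n → ℂ) := by
    refine residual_of_dense_open (hopen.union isClosed_closure.isOpen_compl) ?_
    intro y
    rw [mem_closure_iff]
    intro U hU hyU
    by_cases hy : y ∈ closure (Metric.ball z r)
    · obtain ⟨y', hy'U, hy'B⟩ := mem_closure_iff.1 hy U hU hyU
      have h2 := hne y' hy'B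
      have h3 : ∃ᶠ x in 𝓝 y', h x ≠ 0 := by simpa [Filter.not_eventually] using h2
      obtain ⟨x, hx, hxU, hxB⟩ := (h3.and_eventually
        (Filter.inter_mem (hU.mem_nhds hy'U) (Metric.isOpen_ball.mem_nhds hy'B))).exists
      exact ⟨x, hxU, Or.inl ⟨hxB, hx⟩⟩
    · exact ⟨y, hyU, Or.inr hy⟩
  filter_upwards [mem_inf_of_left (Metric.ball_mem_nhds z hr), mem_inf_of_right hD] with x hx hx'
  rcases hx' with hx' | hx'
  · exact hx'.2
  · exact absurd (subset_closure hx) hx'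

/-- A holomorphic function that vanishes near a point off a meagre set vanishes near it. -/
theorem eventually_zero_of_analyticAt {n : ℕ} {g : (Fin n → ℂ) → ℂ} {z : Fin n → ℂ}
    (ha : AnalyticAt ℂ g z) (h0 : ∀ᶠ x in 𝓝 z ⊓ residual (Fin n → ℂ), g x = 0) :
    ∀ᶠ x in 𝓝 z, g x = 0 := by
  by_contra hcon
  have h1 := (eventually_ne_of_analyticAt ha hcon).and h0
  obtain ⟨s, hs, t, ht, hst⟩ := mem_inf_iff_superset.1 h1
  obtain ⟨x, hxs, hxt⟩ := (dense_of_mem_residual ht).inter_nhds_nonempty hs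
  exact (hst ⟨hxt, hxs⟩).1 (hst ⟨hxt, hxs⟩).2

theorem not_eventually_zero_mul {n : ℕ} {h k : (Fin n → ℂ) → ℂ} {z : Fin n → ℂ}
    (hh : AnalyticAt ℂ h z) (hk : AnalyticAt ℂ k z) (h0 : ¬ ∀ᶠ x in 𝓝 z, h x = 0)
    (k0 : ¬ ∀ᶠ x in 𝓝 z, k x = 0) : ¬ ∀ᶠ x in 𝓝 z, h x * k x = 0 := by
  intro hcon
  apply k0
  apply eventually_zero_of_analyticAt hk
  filter_upwards [eventually_ne_of_analyticAt hh h0,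
    hcon.filter_mono (inf_le_left : 𝓝 z ⊓ residual (Fin n → ℂ) ≤ 𝓝 z)] with x h1 h2
  exact (mul_eq_zero.1 h2).resolve_left h1

theorem IsMero.of_analytic {n : ℕ} {f : (Fin n → ℂ) → ℂ} (hf : ∀ z, AnalyticAt ℂ f z) :
    IsMero f := fun z =>
  ⟨f, fun _ => 1, hf z, analyticAt_const, by simp [NeBot.ne], by simp⟩

theorem IsMero.add {n : ℕ} {f₁ f₂ : (Fin n → ℂ) → ℂ} (h₁ : IsMero f₁) (h₂ : IsMero f₂) :
    IsMero (fun x => f₁ x + f₂ x) := by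
  intro z
  obtain ⟨g, h, hg, hh, h0, e⟩ := h₁ z
  obtain ⟨g', h', hg', hh', h0', e'⟩ := h₂ z
  refine ⟨fun x => g x * h' x + g' x * h x, fun x => h x * h' x, (hg.mul hh').add (hg'.mul hh),
    hh.mul hh', not_eventually_zero_mul hh hh' h0 h0', ?_⟩
  filter_upwards [e, e'] with x e e'
  rw [← e, ← e']; ring

theorem IsMero.mul {n : ℕ} {f₁ f₂ : (Fin n → ℂ) → ℂ} (h₁ : IsMero f₁) (h₂ : IsMero f₂) :
    IsMero (fun x => f₁ x * f₂ x) := by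
  intro z
  obtain ⟨g, h, hg, hh, h0, e⟩ := h₁ z
  obtain ⟨g', h', hg', hh', h0', e'⟩ := h₂ z
  refine ⟨fun x => g x * g' x, fun x => h x * h' x, hg.mul hg',
    hh.mul hh', not_eventually_zero_mul hh hh' h0 h0', ?_⟩
  filter_upwards [e, e'] with x e e'
  rw [← e, ← e']; ring

theorem IsMero.shift {n : ℕ} {f : (Fin n → ℂ) → ℂ} (hf : IsMero f) (α : Fin n → ℂ) :
    IsMero (fun x => f (x + α)) := by
  intro z
  obtain ⟨g, h, hg, hh, h0, e⟩ := hf (z + α)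
  have hsh : AnalyticAt ℂ (fun x : Fin n → ℂ => x + α) z := analyticAt_id.add analyticAt_const
  have hmap : Filter.map (fun x : Fin n → ℂ => x + α) (𝓝 z) = 𝓝 (z + α) :=
    (Homeomorph.addRight α).map_nhds_eq z
  have hres : Tendsto (fun x : Fin n → ℂ => x + α) (residual _) (residual _) :=
    tendsto_residual_of_isOpenMap (continuous_add_const α) (isOpenMap_add_right α)
  refine ⟨fun x => g (x + α), fun x => h (x + α), AnalyticAt.fun_comp hg hsh,
    AnalyticAt.fun_comp hh hsh, fun hc => h0 ?_, ?_⟩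
  · rw [← hmap]; exact hc
  · have : Tendsto (fun x : Fin n → ℂ => x + α) (𝓝 z ⊓ residual _) (𝓝 (z + α) ⊓ residual _) :=
      (tendsto_inf.2 ⟨(Filter.Tendsto.mono_left (show Tendsto _ _ _ from le_of_eq hmap) inf_le_left),
        hres.mono_left inf_le_right⟩)
    exact this.eventually e

/-- The dichotomy behind the field property: a meromorphic function is zero or vanishes only on a
meagre set. -/
theorem IsMero.zero_or_ne {n : ℕ} {f : (Fin n → ℂ) → ℂ} (hf : IsMero f) :
    (∀ᶠ x in residual (Fin n → ℂ), f x = 0) ∨ ∀ᶠ x in residual (Fin n → ℂ), f x ≠ 0 := by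
  set Z : Set (Fin n → ℂ) := {z | ∀ᶠ x in 𝓝 z ⊓ residual (Fin n → ℂ), f x = 0} with hZ
  have hopen : IsOpen Z := by
    rw [isOpen_iff_mem_nhds]
    intro z hz
    obtain ⟨s, hs, t, ht, hst⟩ := mem_inf_iff_superset.1 (show {x | f x = 0} ∈ _ from hz)
    filter_upwards [eventually_mem_nhds_iff.2 hs] with y hy
    exact mem_inf_iff_superset.2 ⟨s, hy, t, ht, hst⟩
  have hclosed : IsClosed Z := by
    rw [← closure_subset_iff_isClosed]
    intro z hz
    obtain ⟨g, h, hg, hh, h0, e⟩ := hf z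
    obtain ⟨s, hs, t, ht, hst⟩ := mem_inf_iff_superset.1 e
    obtain ⟨r, hr, hB⟩ := Metric.eventually_nhds_iff_ball.1 (hg.eventually_analyticAt.and hs)
    have hgB : AnalyticOnNhd ℂ g (Metric.ball z r) := fun x hx => (hB x hx).1
    have hpre : IsPreconnected (Metric.ball z r) := (convex_ball z r).isPreconnected
    obtain ⟨y, hyB, hyZ⟩ := mem_closure_iff.1 hz _ Metric.isOpen_ball (Metric.mem_ball_self hr)
    have hgy : ∀ᶠ x in 𝓝 y ⊓ residual (Fin n → ℂ), g x = 0 := by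
      have hy' : ∀ᶠ x in 𝓝 y ⊓ residual (Fin n → ℂ), f x = 0 := hyZ
      filter_upwards [hy', mem_inf_of_left (Metric.isOpen_ball.mem_nhds hyB),
        mem_inf_of_right ht] with x h1 h2 h3
      have := hst ⟨(hB x h2).2, h3⟩
      simp only [Set.mem_ofPred_eq, h1, zero_mul] at this
      exact this.symm
    have hg0 := hgB.eqOn_zero_of_preconnected_of_eventuallyEq_zero hpre hyB
      (eventually_zero_of_analyticAt (hgB y hyB) hgy)
    change ∀ᶠ x in 𝓝 z ⊓ residual (Fin n → ℂ), f x = 0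
    filter_upwards [e, eventually_ne_of_analyticAt hh h0,
      mem_inf_of_left (Metric.ball_mem_nhds z hr)] with x h1 h2 h3
    rw [hg0 h3] at h1
    exact (mul_eq_zero.1 h1).resolve_right h2
  rcases isClopen_iff.1 ⟨hclosed, hopen⟩ with h | h
  · right
    apply residual_of_locally
    intro z
    obtain ⟨g, k, hg, hk, k0, e⟩ := hf z
    have hg0 : ¬ ∀ᶠ x in 𝓝 z, g x = 0 := by
      intro hg0
      have : z ∈ Z := by
        change ∀ᶠ x in 𝓝 z ⊓ residual (Fin n → ℂ), f x = 0
        filter_upwards [e, eventually_ne_of_analyticAt hk k0,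
          hg0.filter_mono inf_le_left] with x h1 h2 h3
        rw [h3] at h1
        exact (mul_eq_zero.1 h1).resolve_right h2
      rw [h] at this
      exact this
    filter_upwards [e, eventually_ne_of_analyticAt hg hg0] with x h1 h2 h3
    rw [h3, zero_mul] at h1
    exact h2 h1.symm
  · left
    apply residual_of_locally
    intro z
    have : z ∈ Z := by rw [h]; trivial
    exact this

theorem IsMero.inv {n : ℕ} {f : (Fin n → ℂ) → ℂ} (hf : IsMero f)
    (h0 : ∀ᶠ x in residual (Fin n → ℂ), f x ≠ 0) : IsMero (fun x => (f x)⁻¹) := by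
  intro z
  obtain ⟨g, h, hg, hh, hh0, e⟩ := hf z
  have hz := eventually_ne_of_analyticAt hh hh0
  have h0' : ∀ᶠ x in 𝓝 z ⊓ residual (Fin n → ℂ), f x ≠ 0 := h0.filter_mono inf_le_right
  refine ⟨h, g, hh, hg, fun hg0 => ?_, ?_⟩
  · apply hh0
    apply eventually_zero_of_analyticAt hh
    filter_upwards [e, h0', hg0.filter_mono inf_le_left] with x h1 h2 h3
    rw [h3] at h1
    exact (mul_eq_zero.1 h1).resolve_left h2
  · filter_upwards [e, h0'] with x h1 h2
    rw [← h1, inv_mul_cancel_left₀ h2]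

/-- The ring of meromorphic functions on `ℂⁿ`: two of them are equal if their values agree off a
meagre set. -/
noncomputable def merSubring (n : ℕ) : Subring (Germ (residual (Fin n → ℂ)) ℂ) where
  carrier := {φ | ∃ f : (Fin n → ℂ) → ℂ, IsMero f ∧ (f : Germ (residual (Fin n → ℂ)) ℂ) = φ}
  mul_mem' := by
    rintro _ _ ⟨f, hf, rfl⟩ ⟨g, hg, rfl⟩
    exact ⟨_, hf.mul hg, rfl⟩
  one_mem' := ⟨fun _ => 1, .of_analytic fun _ => analyticAt_const, rfl⟩
  add_mem' := by
    rintro _ _ ⟨f, hf, rfl⟩ ⟨g, hg, rfl⟩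
    exact ⟨_, hf.add hg, rfl⟩
  zero_mem' := ⟨fun _ => 0, .of_analytic fun _ => analyticAt_const, rfl⟩
  neg_mem' := by
    rintro _ ⟨f, hf, rfl⟩
    refine ⟨_, (IsMero.of_analytic fun _ => analyticAt_const (v := (-1 : ℂ))).mul hf, ?_⟩
    rw [← Germ.coe_neg]
    congr 1
    funext x
    simp

/-- The field `M` of meromorphic functions on `ℂⁿ`. -/
def Mer (n : ℕ) : Type := merSubring n

noncomputable instance (n : ℕ) : CommRing (Mer n) := inferInstanceAs (CommRing (merSubring n))

/-- The meromorphic function with a given representative. -/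
noncomputable def Mer.mk {n : ℕ} (f : (Fin n → ℂ) → ℂ) (hf : IsMero f) : Mer n :=
  ⟨(f : Germ (residual (Fin n → ℂ)) ℂ), f, hf, rfl⟩

theorem Mer.exists_rep {n : ℕ} (φ : Mer n) : ∃ f, ∃ hf : IsMero f, Mer.mk f hf = φ := by
  obtain ⟨_, f, hf, rfl⟩ := φ
  exact ⟨f, hf, rfl⟩

theorem Mer.mk_eq_mk {n : ℕ} {f g : (Fin n → ℂ) → ℂ} {hf : IsMero f} {hg : IsMero g} :
    Mer.mk f hf = Mer.mk g hg ↔ ∀ᶠ x in residual (Fin n → ℂ), f x = g x :=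
  Subtype.ext_iff.trans Germ.coe_eq

theorem Mer.exists_mul_eq_one {n : ℕ} (φ : Mer n) (h : φ ≠ 0) : ∃ ψ : Mer n, φ * ψ = 1 := by
  obtain ⟨f, hf, rfl⟩ := φ.exists_rep
  rcases hf.zero_or_ne with h0 | h0
  · exact absurd (Mer.mk_eq_mk (hg := .of_analytic fun _ => analyticAt_const (v := (0 : ℂ)))
      |>.2 h0) h
  · refine ⟨Mer.mk _ (hf.inv h0), ?_⟩
    refine (Mer.mk_eq_mk (hf := hf.mul (hf.inv h0))
      (hg := .of_analytic fun _ => analyticAt_const (v := (1 : ℂ)))).2 ?_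
    filter_upwards [h0] with x hx
    exact mul_inv_cancel₀ hx

instance (n : ℕ) : Nontrivial (Mer n) := by
  refine ⟨0, 1, fun h => ?_⟩
  have h1 := (Mer.mk_eq_mk (hf := .of_analytic fun _ => analyticAt_const (v := (0 : ℂ)))
    (hg := .of_analytic fun _ => analyticAt_const (v := (1 : ℂ)))).1
    (show Mer.mk (n := n) _ _ = Mer.mk _ _ from h)
  obtain ⟨x, hx⟩ := (dense_of_mem_residual h1).nonempty
  exact zero_ne_one hx

open Classical in
noncomputable instance (n : ℕ) : Field (Mer n) where
  inv φ := if h : φ = 0 then 0 else (φ.exists_mul_eq_one h).choose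
  mul_inv_cancel φ h := by
    simp only [dif_neg h]
    exact (φ.exists_mul_eq_one h).choose_spec
  inv_zero := by simp
  nnqsmul := _
  nnqsmul_def := fun _ _ => rfl
  qsmul := _
  qsmul_def := fun _ _ => rfl

/-- The constant functions, as a ring homomorphism. -/
noncomputable def Mer.const (n : ℕ) : ℂ →+* Mer n where
  toFun c := Mer.mk (fun _ => c) (.of_analytic fun _ => analyticAt_const)
  map_one' := rfl
  map_mul' _ _ := rfl
  map_zero' := rfl
  map_add' _ _ := rfl

noncomputable instance (n : ℕ) : Algebra ℂ (Mer n) := (Mer.const n).toAlgebra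

/-- The automorphism `(T_α f)(λ) = f(λ + α)` of the field of meromorphic functions. -/
noncomputable def Mer.T {n : ℕ} (α : Fin n → ℂ) (φ : Mer n) : Mer n :=
  Mer.mk (fun x => φ.exists_rep.choose (x + α)) (φ.exists_rep.choose_spec.choose.shift α)

theorem Mer.T_mk {n : ℕ} (α : Fin n → ℂ) (f : (Fin n → ℂ) → ℂ) (hf : IsMero f) :
    Mer.T α (Mer.mk f hf) = Mer.mk (fun x => f (x + α)) (hf.shift α) := by
  refine Mer.mk_eq_mk.2 ?_
  have hres : Tendsto (fun x : Fin n → ℂ => x + α) (residual _) (residual _) :=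
    tendsto_residual_of_isOpenMap (continuous_add_const α) (isOpenMap_add_right α)
  exact hres.eventually (Mer.mk_eq_mk.1 (Mer.mk f hf).exists_rep.choose_spec.choose_spec)

/-! The functions entering the dynamical `R`-matrix.  Throughout `q = exp θ` and
`q ^ z = exp (θ z)` for complex `z`. -/

/-- The constant function `q = exp θ`. -/
noncomputable def qConst (θ : ℂ) (n : ℕ) : Mer n := algebraMap ℂ (Mer n) (Complex.exp θ)

/-- The function `λ ↦ q ^ (-2 (λ_a - λ_b))`. -/
noncomputable def qDiff (θ : ℂ) {n : ℕ} (a b : Fin n) : Mer n :=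
  Mer.mk (fun x => Complex.exp (θ * (-2 * (x a - x b))))
    (.of_analytic fun z => by
      have hc : ∀ i : Fin n, AnalyticAt ℂ (fun x : Fin n → ℂ => x i) z := fun i =>
        (ContinuousLinearMap.proj (R := ℂ) (φ := fun _ : Fin n => ℂ) i).analyticAt z
      exact (analyticAt_const.mul (analyticAt_const.mul ((hc a).sub (hc b)))).cexp)

/-- The function `λ ↦ h₀(λ_a - λ_b)`, where `h₀(z) = (q⁻¹ - q) / (q ^ (-2z) - 1)`. -/
noncomputable def h0Fun (θ : ℂ) {n : ℕ} (a b : Fin n) : Mer n :=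
  ((qConst θ n)⁻¹ - qConst θ n) / (qDiff θ a b - 1)

/-- The function `λ ↦ h(λ_a - λ_b)`, where `h(z) = q (q ^ (-2z) - q⁻²) / (q ^ (-2z) - 1)`. -/
noncomputable def hFun (θ : ℂ) {n : ℕ} (a b : Fin n) : Mer n :=
  qConst θ n * (qDiff θ a b - (qConst θ n)⁻¹ ^ 2) / (qDiff θ a b - 1)

/-- The function `λ ↦ g(λ_a - λ_b)`, where
`g(z) = (q ^ (-2z) - q⁻²) (q ^ (-2z) - q²) / (q ^ (-2z) - 1)²`. -/
noncomputable def gFun (θ : ℂ) {n : ℕ} (a b : Fin n) : Mer n :=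
  (qDiff θ a b - (qConst θ n)⁻¹ ^ 2) * (qDiff θ a b - qConst θ n ^ 2) / (qDiff θ a b - 1) ^ 2

/-- The matrix element `R^{xy}_{ac}`, that is, the coefficient of `v_a ⊗ v_c` in `R(λ)(v_x ⊗ v_y)`,
of
`R(λ) = q ∑_a E_aa ⊗ E_aa + ∑_{a<b} E_aa ⊗ E_bb + ∑_{a>b} g(λ_a - λ_b) E_aa ⊗ E_bb
  + ∑_{a≠b} h₀(λ_a - λ_b) E_ba ⊗ E_ab`. -/
noncomputable def RMat (θ : ℂ) {n : ℕ} (x y a c : Fin n) : Mer n :=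
  (if a = x ∧ c = y then
    (if x = y then qConst θ n else if x < y then 1 else gFun θ x y) else 0) +
  (if x ≠ y ∧ a = y ∧ c = x then h0Fun θ x y else 0)

/-- The weight `ω(i) = e_i`. -/
def wt {n : ℕ} (i : Fin n) : Fin n → ℂ := Pi.single i 1

/-- The homogeneous part of degree `d` of an algebra generated by elements `gen i` of degree
`deg i`: the span of the monomials of degree `d` in the generators. -/
def gradedPiece {A ι D : Type*} [Ring A] [Algebra ℂ A] [AddMonoid D] (gen : ι → A) (deg : ι → D)
    (d : D) : Submodule ℂ A :=
  Submodule.span ℂ {a | ∃ l : List ι, (l.map deg).sum = d ∧ a = (l.map gen).prod}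

/-! The algebra `F_R(M(n))`, obtained from the `R`-matrix by the generalized FRST construction. -/

/-- Generators of `F_R(M(n))`: the functions `f(λ)`, the functions `f(μ)`, and the `t_ij`. -/
inductive FGen (n : ℕ) : Type
  | lam (f : Mer n) : FGen n
  | mu (f : Mer n) : FGen n
  | t (i j : Fin n) : FGen n

open FreeAlgebra in
/-- Defining relations of `F_R(M(n))`.  The first six say that `f ↦ f(λ)` and `f ↦ f(μ)` are
homomorphisms of complex algebras, the last one is the family of the RLL-relations. -/
inductive FRel (θ : ℂ) (n : ℕ) : FreeAlgebra ℂ (FGen n) → FreeAlgebra ℂ (FGen n) → Prop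
  | lam_add (f g : Mer n) : FRel θ n (ι ℂ (.lam (f + g))) (ι ℂ (.lam f) + ι ℂ (.lam g))
  | lam_mul (f g : Mer n) : FRel θ n (ι ℂ (.lam (f * g))) (ι ℂ (.lam f) * ι ℂ (.lam g))
  | lam_const (c : ℂ) : FRel θ n (ι ℂ (.lam (algebraMap ℂ (Mer n) c))) (algebraMap ℂ _ c)
  | mu_add (f g : Mer n) : FRel θ n (ι ℂ (.mu (f + g))) (ι ℂ (.mu f) + ι ℂ (.mu g))
  | mu_mul (f g : Mer n) : FRel θ n (ι ℂ (.mu (f * g))) (ι ℂ (.mu f) * ι ℂ (.mu g))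
  | mu_const (c : ℂ) : FRel θ n (ι ℂ (.mu (algebraMap ℂ (Mer n) c))) (algebraMap ℂ _ c)
  | lam_mu (f g : Mer n) :
      FRel θ n (ι ℂ (.lam f) * ι ℂ (.mu g)) (ι ℂ (.mu g) * ι ℂ (.lam f))
  | lam_t (f : Mer n) (i j : Fin n) :
      FRel θ n (ι ℂ (.lam f) * ι ℂ (.t i j)) (ι ℂ (.t i j) * ι ℂ (.lam (Mer.T (wt i) f)))
  | mu_t (f : Mer n) (i j : Fin n) :
      FRel θ n (ι ℂ (.mu f) * ι ℂ (.t i j)) (ι ℂ (.t i j) * ι ℂ (.mu (Mer.T (wt j) f)))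
  | rll (a b c d : Fin n) :
      FRel θ n
        (∑ x, ∑ y, ι ℂ (.lam (RMat θ x y a c)) * ι ℂ (.t x b) * ι ℂ (.t y d))
        (∑ x, ∑ y, ι ℂ (.mu (RMat θ b d x y)) * ι ℂ (.t c y) * ι ℂ (.t a x))

/-- The algebra `F_R(M(n))`. -/
abbrev FAlg (θ : ℂ) (n : ℕ) : Type := RingQuot (FRel θ n)

/-- The generators as elements of `F_R(M(n))`. -/
noncomputable def fGen (θ : ℂ) {n : ℕ} (s : FGen n) : FAlg θ n :=
  RingQuot.mkAlgHom ℂ (FRel θ n) (FreeAlgebra.ι ℂ s)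

/-- The left moment map `μ_l(f) = f(λ)`. -/
noncomputable def muL (θ : ℂ) {n : ℕ} (f : Mer n) : FAlg θ n := fGen θ (.lam f)

/-- The right moment map `μ_r(f) = f(μ)`. -/
noncomputable def muR (θ : ℂ) {n : ℕ} (f : Mer n) : FAlg θ n := fGen θ (.mu f)

/-- The generator `t_ij`. -/
noncomputable def tGen (θ : ℂ) {n : ℕ} (i j : Fin n) : FAlg θ n := fGen θ (.t i j)

/-- The bidegrees of the generators. -/
def FGen.deg {n : ℕ} : FGen n → (Fin n → ℂ) × (Fin n → ℂ)
  | .lam _ => 0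
  | .mu _ => 0
  | .t i j => (wt i, wt j)

/-- The homogeneous part of bidegree `(α, β)` of `F_R(M(n))`. -/
noncomputable def FAlg.piece (θ : ℂ) {n : ℕ} (α β : Fin n → ℂ) : Submodule ℂ (FAlg θ n) :=
  gradedPiece (fGen θ) FGen.deg (α, β)

/-! The dynamical exterior algebras `W` and `V`. -/

/-- Generators of `W` and of `V`: the functions `f(λ)`, and the vectors `w_i` or `v_i`. -/
inductive EGen (n : ℕ) : Type
  | fn (f : Mer n) : EGen n
  | e (i : Fin n) : EGen n

/-- The degrees of the generators. -/
def EGen.deg {n : ℕ} : EGen n → (Fin n → ℂ)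
  | .fn _ => 0
  | .e i => wt i

open FreeAlgebra in
/-- Defining relations of `W`, namely `w_i² = 0` and `w_j w_i = -h(λ_j - λ_i) w_i w_j` for `i < j`,
next to `f(λ) w_i = w_i f(λ + ω(i))` and the relations of a copy of the meromorphic functions. -/
inductive WRel (θ : ℂ) (n : ℕ) : FreeAlgebra ℂ (EGen n) → FreeAlgebra ℂ (EGen n) → Prop
  | fn_add (f g : Mer n) : WRel θ n (ι ℂ (.fn (f + g))) (ι ℂ (.fn f) + ι ℂ (.fn g))
  | fn_mul (f g : Mer n) : WRel θ n (ι ℂ (.fn (f * g))) (ι ℂ (.fn f) * ι ℂ (.fn g))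
  | fn_const (c : ℂ) : WRel θ n (ι ℂ (.fn (algebraMap ℂ (Mer n) c))) (algebraMap ℂ _ c)
  | fn_e (f : Mer n) (i : Fin n) :
      WRel θ n (ι ℂ (.fn f) * ι ℂ (.e i)) (ι ℂ (.e i) * ι ℂ (.fn (Mer.T (wt i) f)))
  | sq (i : Fin n) : WRel θ n (ι ℂ (.e i) * ι ℂ (.e i)) 0
  | anti (i j : Fin n) (hij : i < j) :
      WRel θ n (ι ℂ (.e j) * ι ℂ (.e i)) (-(ι ℂ (.fn (hFun θ j i)) * ι ℂ (.e i) * ι ℂ (.e j)))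

open FreeAlgebra in
/-- Defining relations of `V`, namely `v_i² = 0` and `v_i v_j = -h(λ_i - λ_j) v_j v_i` for `i < j`,
next to `f(λ) v_i = v_i f(λ + ω(i))` and the relations of a copy of the meromorphic functions. -/
inductive VRel (θ : ℂ) (n : ℕ) : FreeAlgebra ℂ (EGen n) → FreeAlgebra ℂ (EGen n) → Prop
  | fn_add (f g : Mer n) : VRel θ n (ι ℂ (.fn (f + g))) (ι ℂ (.fn f) + ι ℂ (.fn g))
  | fn_mul (f g : Mer n) : VRel θ n (ι ℂ (.fn (f * g))) (ι ℂ (.fn f) * ι ℂ (.fn g))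
  | fn_const (c : ℂ) : VRel θ n (ι ℂ (.fn (algebraMap ℂ (Mer n) c))) (algebraMap ℂ _ c)
  | fn_e (f : Mer n) (i : Fin n) :
      VRel θ n (ι ℂ (.fn f) * ι ℂ (.e i)) (ι ℂ (.e i) * ι ℂ (.fn (Mer.T (wt i) f)))
  | sq (i : Fin n) : VRel θ n (ι ℂ (.e i) * ι ℂ (.e i)) 0
  | anti (i j : Fin n) (hij : i < j) :
      VRel θ n (ι ℂ (.e i) * ι ℂ (.e j)) (-(ι ℂ (.fn (hFun θ i j)) * ι ℂ (.e j) * ι ℂ (.e i)))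

/-- The algebra `W`. -/
abbrev WAlg (θ : ℂ) (n : ℕ) : Type := RingQuot (WRel θ n)

/-- The algebra `V`. -/
abbrev VAlg (θ : ℂ) (n : ℕ) : Type := RingQuot (VRel θ n)

/-- The generators as elements of `W`. -/
noncomputable def wGen (θ : ℂ) {n : ℕ} (s : EGen n) : WAlg θ n :=
  RingQuot.mkAlgHom ℂ (WRel θ n) (FreeAlgebra.ι ℂ s)

/-- The generators as elements of `V`. -/
noncomputable def vGen (θ : ℂ) {n : ℕ} (s : EGen n) : VAlg θ n :=
  RingQuot.mkAlgHom ℂ (VRel θ n) (FreeAlgebra.ι ℂ s)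

/-- The homogeneous part of degree `α` of `W`. -/
noncomputable def WAlg.piece (θ : ℂ) {n : ℕ} (α : Fin n → ℂ) : Submodule ℂ (WAlg θ n) :=
  gradedPiece (wGen θ) EGen.deg α

/-- The homogeneous part of degree `α` of `V`. -/
noncomputable def VAlg.piece (θ : ℂ) {n : ℕ} (α : Fin n → ℂ) : Submodule ℂ (VAlg θ n) :=
  gradedPiece (vGen θ) EGen.deg α

/-- `w_I = w_{i_1} ⋯ w_{i_r}` for `I = {i_1 < ⋯ < i_r}`. -/
noncomputable def wSet (θ : ℂ) {n : ℕ} (I : Finset (Fin n)) : WAlg θ n :=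
  (I.sort.map fun i => wGen θ (.e i)).prod

/-- `v_I = v_{i_r} ⋯ v_{i_1}` for `I = {i_1 < ⋯ < i_r}`. -/
noncomputable def vSet (θ : ℂ) {n : ℕ} (I : Finset (Fin n)) : VAlg θ n :=
  (I.sort.reverse.map fun i => vGen θ (.e i)).prod

/-! The algebra `W ⊗̃ F_R(M(n))`: inside `W ⊗_ℂ F` one takes the sum of all `W_α ⊗_ℂ F_{αβ}`, which is
a subalgebra, and divides by the relations `f v ⊗ a = v ⊗ μ_l(f) a` for `v ∈ W_α`, `a ∈ F_{αβ}`; the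
span of these relations is a two-sided ideal.  Similarly for `F_R(M(n)) ⊗̃ V`. -/

/-- The sum of all `W_α ⊗_ℂ F_{αβ}`.  As the pure tensors below are closed under products, the
subalgebra that they generate is their span. -/
noncomputable def WFPre (θ : ℂ) (n : ℕ) : Subalgebra ℂ (WAlg θ n ⊗[ℂ] FAlg θ n) :=
  Algebra.adjoin ℂ {x | ∃ (α β : Fin n → ℂ) (w : WAlg θ n) (a : FAlg θ n),
    w ∈ WAlg.piece θ α ∧ a ∈ FAlg.piece θ α β ∧ x = w ⊗ₜ[ℂ] a}

/-- The relations `f w ⊗ a = w ⊗ μ_l(f) a`. -/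
def WFRel (θ : ℂ) (n : ℕ) (x y : WFPre θ n) : Prop :=
  ∃ (α β : Fin n → ℂ) (f : Mer n) (w : WAlg θ n) (a : FAlg θ n),
    w ∈ WAlg.piece θ α ∧ a ∈ FAlg.piece θ α β ∧
    (x : WAlg θ n ⊗[ℂ] FAlg θ n) = (wGen θ (.fn f) * w) ⊗ₜ[ℂ] a ∧
    (y : WAlg θ n ⊗[ℂ] FAlg θ n) = w ⊗ₜ[ℂ] (muL θ f * a)

/-- The algebra `W ⊗̃ F_R(M(n))`. -/
abbrev WF (θ : ℂ) (n : ℕ) : Type := (ringConGen (WFRel θ n)).Quotient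

/-- The element `z` of `W ⊗̃ F_R(M(n))` is given by the expression `x = ∑ w ⊗ a`. -/
def WF.IsRep {θ : ℂ} {n : ℕ} (z : WF θ n) (x : WAlg θ n ⊗[ℂ] FAlg θ n) : Prop :=
  ∃ p : WFPre θ n, (p : WAlg θ n ⊗[ℂ] FAlg θ n) = x ∧ (p : WF θ n) = z

/-- The sum of all `F_{αβ} ⊗_ℂ V_β`. -/
noncomputable def FVPre (θ : ℂ) (n : ℕ) : Subalgebra ℂ (FAlg θ n ⊗[ℂ] VAlg θ n) :=
  Algebra.adjoin ℂ {x | ∃ (α β : Fin n → ℂ) (a : FAlg θ n) (v : VAlg θ n),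
    a ∈ FAlg.piece θ α β ∧ v ∈ VAlg.piece θ β ∧ x = a ⊗ₜ[ℂ] v}

/-- The relations `μ_r(f) a ⊗ v = a ⊗ f v`. -/
def FVRel (θ : ℂ) (n : ℕ) (x y : FVPre θ n) : Prop :=
  ∃ (α β : Fin n → ℂ) (f : Mer n) (a : FAlg θ n) (v : VAlg θ n),
    a ∈ FAlg.piece θ α β ∧ v ∈ VAlg.piece θ β ∧
    (x : FAlg θ n ⊗[ℂ] VAlg θ n) = (muR θ f * a) ⊗ₜ[ℂ] v ∧
    (y : FAlg θ n ⊗[ℂ] VAlg θ n) = a ⊗ₜ[ℂ] (vGen θ (.fn f) * v)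

/-- The algebra `F_R(M(n)) ⊗̃ V`. -/
abbrev FV (θ : ℂ) (n : ℕ) : Type := (ringConGen (FVRel θ n)).Quotient

/-- The element `z` of `F_R(M(n)) ⊗̃ V` is given by the expression `x = ∑ a ⊗ v`. -/
def FV.IsRep {θ : ℂ} {n : ℕ} (z : FV θ n) (x : FAlg θ n ⊗[ℂ] VAlg θ n) : Prop :=
  ∃ p : FVPre θ n, (p : FAlg θ n ⊗[ℂ] VAlg θ n) = x ∧ (p : FV θ n) = z

/-- The right exterior corepresentation: the algebra homomorphism `R : W → W ⊗̃ F_R(M(n))`, linear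
over the meromorphic functions (`R(f) = f R(1) = 1 ⊗ μ_r(f)`), with `R(w_i) = ∑_j w_j ⊗ t_ji`. -/
def IsRightExterior {θ : ℂ} {n : ℕ} (R : WAlg θ n →ₐ[ℂ] WF θ n) : Prop :=
  (∀ f : Mer n, (R (wGen θ (.fn f))).IsRep (1 ⊗ₜ[ℂ] muR θ f)) ∧
  ∀ i : Fin n, (R (wGen θ (.e i))).IsRep (∑ j, wGen θ (.e j) ⊗ₜ[ℂ] tGen θ j i)

/-- The left exterior corepresentation: the algebra homomorphism `L : V → F_R(M(n)) ⊗̃ V`, linear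
over the meromorphic functions (`L(f) = f L(1) = μ_l(f) ⊗ 1`), with `L(v_i) = ∑_j t_ij ⊗ v_j`. -/
def IsLeftExterior {θ : ℂ} {n : ℕ} (L : VAlg θ n →ₐ[ℂ] FV θ n) : Prop :=
  (∀ f : Mer n, (L (vGen θ (.fn f))).IsRep (muL θ f ⊗ₜ[ℂ] 1)) ∧
  ∀ i : Fin n, (L (vGen θ (.e i))).IsRep (∑ j, tGen θ i j ⊗ₜ[ℂ] vGen θ (.e j))

/-- `ξ I J = ξ^I_J` are the matrix elements of `R`: `R(w_J) = ∑_{#I = #J} w_I ⊗ ξ^I_J`, with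
`ξ^I_J = 0` if `#I ≠ #J`. -/
def IsRightMinors {θ : ℂ} {n : ℕ} (R : WAlg θ n →ₐ[ℂ] WF θ n)
    (ξ : Finset (Fin n) → Finset (Fin n) → FAlg θ n) : Prop :=
  (∀ I J, I.card ≠ J.card → ξ I J = 0) ∧
  ∀ J, (R (wSet θ J)).IsRep (∑ I with I.card = J.card, wSet θ I ⊗ₜ[ℂ] ξ I J)

/-- `η I J = η^I_J` are the matrix elements of `L`: `L(v_I) = ∑_{#J = #I} η^I_J ⊗ v_J`, with
`η^I_J = 0` if `#I ≠ #J`. -/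
def IsLeftMinors {θ : ℂ} {n : ℕ} (L : VAlg θ n →ₐ[ℂ] FV θ n)
    (η : Finset (Fin n) → Finset (Fin n) → FAlg θ n) : Prop :=
  (∀ I J, I.card ≠ J.card → η I J = 0) ∧
  ∀ I, (L (vSet θ I)).IsRep (∑ J with J.card = I.card, η I J ⊗ₜ[ℂ] vSet θ J)

end DynU

namespace DynU

/-! For an arrangement `l` of a set `J` let c_<(l) and c_>(l) (`listCoeff`) be the meromorphic
functions with w_l = c_<(l) w_J and v_l = c_>(l) v_J, where w_l and v_l are the products in the
order of `l`. Expand R(w_l) over all words and compare the coefficients of w_I. For every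
arrangement l of J this gives ∑_p c_<(p)(λ) t_{p_1 l_1} ⋯ t_{p_m l_m} = c_<(l)(μ) ξ^I_J, the sum
being over the arrangements p of I. In the same way L(v_p) gives, for every arrangement p of I, ∑_l
c_>(l)(μ) t_{p_1 l_1} ⋯ t_{p_m l_m} = c_>(p)(λ) η^I_J. Both are instances of
`ExteriorCoaction.minor_eq`. Multiply the first by c_>(l)(μ) and sum over l, multiply the second by
c_<(p)(λ) and sum over p. Since functions of λ and of μ commute, the left sides become the same
double sum. Hence C_J(μ) ξ^I_J = C_I(λ) η^I_J, where C_K = ∑ c_<(l) c_>(l) over the arrangements l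
of K.

Each pair of positions contributes a factor to exactly one of c_<(l) and c_>(l), so c_<(l) c_>(l) is
the product of -h(λ_a - λ_b) over all pairs with a before b in l. The Hall–Littlewood identity ∑_i
∏_{k≠i} h(λ_i - λ_k) = (q^m - q^{-m}) / (q - q⁻¹) then shows by induction that C_K is, up to sign,
the q-factorial of m = #K (`sum_listCoeff_mul`). This is a constant, hence the same on both sides,
and it is nonzero by the assumption on q.

Three facts justify comparing coefficients. The RLL relations imply that the images of the
generators satisfy the exterior relations, so R and L exist (`exteriorCoaction_W`,
`exteriorCoaction_V`). The ordered products are linearly independent, by an explicit representation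
(`isExterior_genRep`). The relations defining the tensor products span an ideal, so coefficient
functionals are well defined on the quotients (`DynTensor.sub_mem_balancing`). -/

/-! ### Shifts of meromorphic functions and the coordinates q^(-2λ_a) -/

theorem Mer.mk_mul_mk {n : ℕ} {f g : (Fin n → ℂ) → ℂ} (hf : IsMero f) (hg : IsMero g) :
    Mer.mk f hf * Mer.mk g hg = Mer.mk _ (hf.mul hg) := rfl

theorem Mer.mk_add_mk {n : ℕ} {f g : (Fin n → ℂ) → ℂ} (hf : IsMero f) (hg : IsMero g) :
    Mer.mk f hf + Mer.mk g hg = Mer.mk _ (hf.add hg) := rfl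

/-- The shift `T_α` as an algebra endomorphism. -/
noncomputable def Mer.shift {n : ℕ} (α : Fin n → ℂ) : Mer n →ₐ[ℂ] Mer n where
  toFun := Mer.T α
  map_one' := Mer.T_mk α (fun _ => 1) (.of_analytic fun _ => analyticAt_const)
  map_zero' := Mer.T_mk α (fun _ => 0) (.of_analytic fun _ => analyticAt_const)
  map_mul' φ ψ := by
    obtain ⟨f, hf, rfl⟩ := φ.exists_rep
    obtain ⟨g, hg, rfl⟩ := ψ.exists_rep
    rw [Mer.mk_mul_mk, Mer.T_mk, Mer.T_mk, Mer.T_mk, Mer.mk_mul_mk]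
  map_add' φ ψ := by
    obtain ⟨f, hf, rfl⟩ := φ.exists_rep
    obtain ⟨g, hg, rfl⟩ := ψ.exists_rep
    rw [Mer.mk_add_mk, Mer.T_mk, Mer.T_mk, Mer.T_mk, Mer.mk_add_mk]
  commutes' c := Mer.T_mk α (fun _ => c) (.of_analytic fun _ => analyticAt_const)

theorem Mer.shift_apply {n : ℕ} (α : Fin n → ℂ) (f : Mer n) : Mer.shift α f = Mer.T α f := rfl

theorem Mer.shift_zero {n : ℕ} (f : Mer n) : Mer.shift 0 f = f := by
  obtain ⟨f, hf, rfl⟩ := f.exists_rep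
  rw [Mer.shift_apply, Mer.T_mk]
  simp

theorem Mer.shift_add {n : ℕ} (α β : Fin n → ℂ) (f : Mer n) :
    Mer.shift (α + β) f = Mer.shift β (Mer.shift α f) := by
  obtain ⟨f, hf, rfl⟩ := f.exists_rep
  simp only [Mer.shift_apply, Mer.T_mk]
  refine Mer.mk_eq_mk.2 (.of_forall fun x => ?_)
  congr 1
  abel

theorem Mer.shift_neg_shift {n : ℕ} (α : Fin n → ℂ) (f : Mer n) :
    Mer.shift (-α) (Mer.shift α f) = f := by
  rw [← Mer.shift_add, add_neg_cancel, Mer.shift_zero]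

theorem Mer.shift_shift_neg {n : ℕ} (α : Fin n → ℂ) (f : Mer n) :
    Mer.shift α (Mer.shift (-α) f) = f := by
  rw [← Mer.shift_add, neg_add_cancel, Mer.shift_zero]

theorem shift_qConst (θ : ℂ) {n : ℕ} (α : Fin n → ℂ) :
    Mer.shift α (qConst θ n) = qConst θ n := (Mer.shift α).commutes _

theorem shift_qDiff (θ : ℂ) {n : ℕ} (α : Fin n → ℂ) {a b : Fin n} (h : α a = α b) :
    Mer.shift α (qDiff θ a b) = qDiff θ a b := by
  rw [qDiff, Mer.shift_apply, Mer.T_mk]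
  refine Mer.mk_eq_mk.2 (.of_forall fun x => ?_)
  simp [h]

theorem shift_hFun (θ : ℂ) {n : ℕ} (α : Fin n → ℂ) {a b : Fin n} (h : α a = α b) :
    Mer.shift α (hFun θ a b) = hFun θ a b := by
  simp only [hFun, map_div₀, map_mul, map_sub, map_pow, map_inv₀, map_one, shift_qConst,
    shift_qDiff θ α h]

theorem qConst_ne_zero (θ : ℂ) (n : ℕ) : qConst θ n ≠ 0 := by
  rw [qConst, Ne, map_eq_zero]
  exact Complex.exp_ne_zero θ

/-- The function `λ ↦ q ^ (-2 λ_a)`. -/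
noncomputable def qCoord (θ : ℂ) {n : ℕ} (a : Fin n) : Mer n :=
  Mer.mk (fun x => Complex.exp (θ * (-2 * x a)))
    (.of_analytic fun z =>
      (analyticAt_const.mul (analyticAt_const.mul
        ((ContinuousLinearMap.proj (R := ℂ) (φ := fun _ : Fin n => ℂ) a).analyticAt z))).cexp)

theorem qDiff_mul_qCoord (θ : ℂ) {n : ℕ} (a b : Fin n) :
    qDiff θ a b * qCoord θ b = qCoord θ a := by
  rw [qDiff, qCoord, Mer.mk_mul_mk]
  refine Mer.mk_eq_mk.2 (.of_forall fun x => ?_)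
  rw [← Complex.exp_add]
  congr 1
  ring

theorem qCoord_ne_zero (θ : ℂ) {n : ℕ} (a : Fin n) : qCoord θ a ≠ 0 := by
  intro h
  have h1 := Mer.mk_eq_mk.1 (h.trans (show (0 : Mer n) = Mer.mk (fun _ => 0)
    (.of_analytic fun _ => analyticAt_const) from rfl))
  obtain ⟨x, hx⟩ := (dense_of_mem_residual h1).nonempty
  exact Complex.exp_ne_zero _ hx

theorem qCoord_injective {θ : ℂ} (hθ : Complex.exp θ ^ 2 ≠ 1) {n : ℕ} :
    Function.Injective (qCoord θ (n := n)) := by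
  intro a b h
  by_contra hab
  have h1 := Mer.mk_eq_mk.1 h
  have h2 : (fun x : Fin n → ℂ => Complex.exp (θ * (-2 * x a))) =
      fun x => Complex.exp (θ * (-2 * x b)) :=
    Continuous.ext_on (dense_of_mem_residual h1) (by fun_prop) (by fun_prop) fun x hx => hx
  -- At the point -e_a the two functions take the values q² and 1.
  have h3 := congrFun h2 (Pi.single a (-1))
  simp only [Pi.single_eq_same, Pi.single_eq_of_ne (Ne.symm hab), mul_zero, Complex.exp_zero] at h3
  apply hθ
  rw [← Complex.exp_nat_mul, ← h3]
  congr 1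
  push_cast
  ring

/-- With y_a = q^(-2λ_a), the function h becomes homogeneous of degree 0 in y_a and y_b, which is
the shape of the factors in `sum_prod_erase_div`. -/
theorem hFun_eq (θ : ℂ) {n : ℕ} (a b : Fin n) :
    hFun θ a b = (qConst θ n * qCoord θ a - (qConst θ n)⁻¹ * qCoord θ b) /
      (qCoord θ a - qCoord θ b) := by
  have hb := qCoord_ne_zero θ b
  have hq := qConst_ne_zero θ n
  rw [hFun, ← qDiff_mul_qCoord θ a b, ← mul_div_mul_right _ _ hb]
  congr 1 <;> field_simp

theorem h0Fun_eq {θ : ℂ} (hθ : Complex.exp θ ^ 2 ≠ 1) {n : ℕ} {a b : Fin n} (hab : a ≠ b) :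
    h0Fun θ a b = qConst θ n - hFun θ a b := by
  have hb := qCoord_ne_zero θ b
  have hq := qConst_ne_zero θ n
  have h := sub_ne_zero.2 ((qCoord_injective hθ (n := n)).ne hab)
  have h1 : h0Fun θ a b = ((qConst θ n)⁻¹ - qConst θ n) * qCoord θ b /
      (qCoord θ a - qCoord θ b) := by
    rw [h0Fun, ← qDiff_mul_qCoord θ a b, ← mul_div_mul_right _ _ hb]
    congr 1
    ring
  rw [h1, hFun_eq, eq_sub_iff_add_eq, ← add_div, div_eq_iff h]
  ring

theorem gFun_eq (θ : ℂ) {n : ℕ} (a b : Fin n) :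
    gFun θ a b = hFun θ a b * hFun θ b a := by
  have ha := qCoord_ne_zero θ a
  have hb := qCoord_ne_zero θ b
  have hq := qConst_ne_zero θ n
  have h1 : gFun θ a b = (qCoord θ a - (qConst θ n)⁻¹ ^ 2 * qCoord θ b) *
      (qCoord θ a - qConst θ n ^ 2 * qCoord θ b) / (qCoord θ a - qCoord θ b) ^ 2 := by
    rw [gFun, ← qDiff_mul_qCoord θ a b, ← mul_div_mul_right _ _ (pow_ne_zero 2 hb)]
    congr 1 <;> ring
  rw [h1, hFun_eq, hFun_eq, div_mul_div_comm, ← neg_sub (qCoord θ a) (qCoord θ b), mul_neg, ← sq,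
    div_neg, ← neg_div]
  congr 1
  field_simp
  ring

/-! ### The Hall–Littlewood identity -/

/-- The partial fraction identity behind the Hall–Littlewood polynomials. -/
theorem sum_prod_erase_div {K ι : Type*} [Field K] [DecidableEq ι] (s : Finset ι) (y : ι → K)
    (hy : Set.InjOn y s) (h0 : ∀ i ∈ s, y i ≠ 0) (p q : K) :
    (p - q) * ∑ i ∈ s, ∏ k ∈ s.erase i, (p * y i - q * y k) / (y i - y k) =
      p ^ s.card - q ^ s.card := by
  -- Lagrange interpolation of P = ∏ (p X - q y_k) at the `s.card + 1` nodes y_i and 0, the node 0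
  -- being `none`, expresses the top coefficient p^m. The node 0 contributes q^m. At the node y_i
  -- the factor (p - q) y_i of P cancels the y_i = y_i - 0 of the denominator, leaving (p - q) times
  -- the i-th summand.
  open Polynomial in
  let v : Option ι → K := fun o => o.elim 0 y
  have hv : Set.InjOn v (Finset.insertNone s) := by
    rintro (_ | a) ha (_ | b) hb hab
    · rfl
    · exact absurd hab.symm (h0 b (by simpa using hb))
    · exact absurd hab (h0 a (by simpa using ha))
    · rw [hy (by simpa using ha) (by simpa using hb) hab]
  let P : Polynomial K := ∏ k ∈ s, (C p * X - C (q * y k))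
  have hdeg : ∀ k ∈ s, (C p * X - C (q * y k)).natDegree ≤ 1 := fun k _ => by
    compute_degree
  have hP : P.natDegree ≤ s.card := by
    refine (natDegree_prod_le _ _).trans ((Finset.sum_le_sum hdeg).trans ?_)
    simp
  have key := Lagrange.coeff_eq_sum hv (P := P) (by
    rw [Finset.card_insertNone]
    exact lt_of_le_of_lt degree_le_natDegree (by exact_mod_cast Nat.lt_succ_of_le hP))
  have hc : P.coeff s.card = p ^ s.card := by
    have := coeff_prod_of_natDegree_le (s := s) (fun k => C p * X - C (q * y k)) 1 hdeg
    rw [mul_one] at this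
    rw [show P = ∏ k ∈ s, (C p * X - C (q * y k)) from rfl, this]
    simp [coeff_C]
  rw [Finset.card_insertNone, Nat.add_sub_cancel, hc, Finset.sum_insertNone] at key
  have e0 : P.eval (v none) / ∏ j ∈ (Finset.insertNone s).erase none, (v none - v j) =
      q ^ s.card := by
    have : (Finset.insertNone s).erase none = s.map Function.Embedding.some := by
      ext (_ | a) <;> simp
    rw [this, Finset.prod_map, eval_prod, ← Finset.prod_div_distrib, ← Finset.prod_const]
    refine Finset.prod_congr rfl fun k hk => ?_
    have := h0 k hk
    simp [v]
    field_simp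
  have e1 : ∀ i ∈ s, P.eval (v (some i)) /
      ∏ j ∈ (Finset.insertNone s).erase (some i), (v (some i) - v j) =
      (p - q) * ∏ k ∈ s.erase i, (p * y i - q * y k) / (y i - y k) := by
    intro i hi
    have : (Finset.insertNone s).erase (some i) = Finset.insertNone (s.erase i) := by
      ext (_ | a) <;> simp
    rw [this, Finset.prod_insertNone, eval_prod, Finset.prod_div_distrib,
      ← Finset.mul_prod_erase s _ hi]
    have := h0 i hi
    simp only [v, Option.elim, eval_sub, eval_mul, eval_C, eval_X, sub_zero, ← sub_mul]
    rw [mul_comm (p - q) (y i), mul_assoc, mul_div_mul_left _ _ this, mul_div_assoc]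
  rw [e0, Finset.sum_congr rfl e1, ← Finset.mul_sum] at key
  rw [key]
  ring

/-! ### Coefficients of normal ordering -/

/-- The factor picked up when the `i`-th generator of a dynamical exterior algebra is moved past
the `k`-th one into the order `r`. -/
noncomputable def swapCoeff (θ : ℂ) {n : ℕ} (r : Fin n → Fin n → Prop) [DecidableRel r]
    (i k : Fin n) : Mer n :=
  if r k i then -hFun θ i k else 1

/-- The coefficient of the product of the generators in the list `l`, brought into the order `r`. -/
noncomputable def listCoeff (θ : ℂ) {n : ℕ} (r : Fin n → Fin n → Prop) [DecidableRel r] :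
    List (Fin n) → Mer n
  | [] => 1
  | i :: l => if i ∈ l then 0 else (∏ k ∈ l.toFinset, swapCoeff θ r i k) * listCoeff θ r l

section

variable {θ : ℂ} {n : ℕ} {r : Fin n → Fin n → Prop} [DecidableRel r]

theorem shift_swapCoeff {α : Fin n → ℂ} {i k : Fin n} (h : α i = α k) :
    Mer.shift α (swapCoeff θ r i k) = swapCoeff θ r i k := by
  rw [swapCoeff]
  split_ifs
  · rw [map_neg, shift_hFun θ α h]
  · exact map_one _

theorem shift_prod_swapCoeff {α : Fin n → ℂ} {i : Fin n} {I : Finset (Fin n)}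
    (h : ∀ k ∈ I, α i = α k) :
    Mer.shift α (∏ k ∈ I, swapCoeff θ r i k) = ∏ k ∈ I, swapCoeff θ r i k := by
  rw [map_prod]
  exact Finset.prod_congr rfl fun k hk => shift_swapCoeff (h k hk)

/-- The coefficient involves only coordinates with index in `l`. This is why a coefficient can be
moved past a generator whose index does not occur in `l` without being shifted. -/
theorem shift_listCoeff {α : Fin n → ℂ} {l : List (Fin n)}
    (h : ∀ k ∈ l, α k = 0) : Mer.shift α (listCoeff θ r l) = listCoeff θ r l := by
  induction l with
  | nil => exact map_one _
  | cons i l ih =>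
    rw [listCoeff]
    split_ifs
    · exact map_zero _
    · rw [map_mul, ih fun k hk => h k (List.mem_cons_of_mem _ hk), shift_prod_swapCoeff]
      intro k hk
      rw [h i List.mem_cons_self, h k (List.mem_cons_of_mem _ (List.mem_toFinset.1 hk))]

theorem wt_apply_of_notMem {i : Fin n} {l : List (Fin n)} (hi : i ∉ l) :
    ∀ k ∈ l, wt i k = 0 := fun k hk =>
  by
  rw [wt, Pi.single_eq_of_ne]
  rintro rfl
  exact hi hk

theorem listCoeff_eq_zero {l : List (Fin n)} (hl : ¬ l.Nodup) : listCoeff θ r l = 0 := by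
  induction l with
  | nil => exact absurd List.nodup_nil hl
  | cons i l ih =>
    rw [listCoeff]
    split_ifs with h
    · rfl
    · rw [ih fun h' => hl (List.nodup_cons.2 ⟨h, h'⟩), mul_zero]

theorem listCoeff_of_pairwise (hr : ∀ i k, r i k → ¬ r k i) {l : List (Fin n)}
    (hl : l.Pairwise r) : listCoeff θ r l = 1 := by
  induction l with
  | nil => rfl
  | cons i l ih =>
    rw [List.pairwise_cons] at hl
    rw [listCoeff, if_neg fun h => hr i i (hl.1 i h) (hl.1 i h), ih hl.2, mul_one]
    refine Finset.prod_eq_one fun k hk => if_neg ?_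
    exact hr _ _ (hl.1 k (List.mem_toFinset.1 hk))

end

/-! ### Normal ordering in a dynamical exterior algebra -/

/-- A pair consisting of a homomorphism `φ` from the meromorphic functions and of elements `X i`
that satisfy the relations of a dynamical exterior algebra with respect to the order `r`. -/
structure IsExterior (θ : ℂ) {n : ℕ} (r : Fin n → Fin n → Prop) {A : Type*} [Ring A] [Algebra ℂ A]
    (φ : Mer n →ₐ[ℂ] A) (X : Fin n → A) : Prop where
  comm : ∀ f i, φ f * X i = X i * φ (Mer.shift (wt i) f)
  sq : ∀ i, X i * X i = 0
  anti : ∀ i j, r i j → X j * X i = -(φ (hFun θ j i) * X i * X j)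

namespace IsExterior

variable {θ : ℂ} {n : ℕ} {r : Fin n → Fin n → Prop} {A : Type*} [Ring A]
  [Algebra ℂ A] {φ : Mer n →ₐ[ℂ] A} {X : Fin n → A}

theorem commute (H : IsExterior θ r φ X) {f : Mer n} {i : Fin n}
    (hf : Mer.shift (wt i) f = f) : X i * φ f = φ f * X i := by
  rw [H.comm, hf]

/-- `X i` is moved to the right past the smaller factors until it meets its own copy. -/
theorem mul_prod_of_mem (H : IsExterior θ r φ X) {i : Fin n}
    {l : List (Fin n)} (hl : l.Pairwise r) (hi : i ∈ l) : X i * (l.map X).prod = 0 := by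
  induction l with
  | nil => exact absurd hi List.not_mem_nil
  | cons k l ih =>
    rw [List.pairwise_cons] at hl
    rw [List.map_cons, List.prod_cons, ← mul_assoc]
    rcases List.mem_cons.1 hi with rfl | hi
    · rw [H.sq, zero_mul]
    · rw [H.anti k i (hl.1 i hi), neg_mul, mul_assoc, ih hl.2 hi, mul_zero, neg_zero]

/-- This is one step of insertion sort. Each factor `k` preceding `i` that is passed costs -h(λ_i -
λ_k). The factors after the place of insertion all follow `i` by transitivity, so their `swapCoeff`
is 1. -/
theorem mul_prod_of_notMem [DecidableRel r] (H : IsExterior θ r φ X)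
    (hr : ∀ i k, r i k → ¬ r k i)
    (ht : ∀ i j k, r i j → r j k → r i k) (htri : ∀ i k, i ≠ k → r i k ∨ r k i)
    {i : Fin n} {l : List (Fin n)} (hl : l.Pairwise r) (hi : i ∉ l) :
    ∃ l' : List (Fin n), l'.Pairwise r ∧ l'.Perm (i :: l) ∧
      X i * (l.map X).prod = φ (∏ k ∈ l.toFinset, swapCoeff θ r i k) * (l'.map X).prod := by
  induction l with
  | nil => exact ⟨[i], List.pairwise_singleton _ _, .refl _, by simp⟩
  | cons k l ih =>
    rw [List.mem_cons, not_or] at hi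
    rcases htri i k hi.1 with h | h
    · refine ⟨i :: k :: l, List.pairwise_cons.2 ⟨fun j hj => ?_, hl⟩, .refl _, ?_⟩
      · rcases List.mem_cons.1 hj with rfl | hj
        · exact h
        · exact ht _ _ _ h ((List.pairwise_cons.1 hl).1 j hj)
      · rw [Finset.prod_eq_one, map_one, one_mul]
        · simp only [List.map_cons, List.prod_cons]
        intro j hj
        refine if_neg (hr _ _ ?_)
        rcases List.mem_cons.1 (List.mem_toFinset.1 hj) with rfl | hj
        · exact h
        · exact ht _ _ _ h ((List.pairwise_cons.1 hl).1 j hj)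
    · rw [List.pairwise_cons] at hl
      obtain ⟨l', h1, h2, h3⟩ := ih hl.2 hi.2
      have hk : k ∉ l := fun hk => hr _ _ (hl.1 k hk) (hl.1 k hk)
      refine ⟨k :: l', List.pairwise_cons.2 ⟨fun j hj => ?_, h1⟩,
        (h2.cons k).trans (.swap _ _ _), ?_⟩
      · rcases List.mem_cons.1 (h2.mem_iff.1 hj) with rfl | hj
        · exact h
        · exact hl.1 j hj
      · rw [List.map_cons, List.prod_cons, ← mul_assoc, H.anti k i h, neg_mul, mul_assoc, h3,
          mul_assoc, ← mul_assoc (X k), H.commute, List.toFinset_cons,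
          Finset.prod_insert (by simpa using hk), swapCoeff, if_pos h, map_mul, map_neg,
          List.map_cons, List.prod_cons]
        · simp only [neg_mul, mul_assoc]
        · refine shift_prod_swapCoeff fun j hj => ?_
          rw [wt, Pi.single_eq_of_ne hi.1, Pi.single_eq_of_ne]
          rintro rfl
          exact hk (List.mem_toFinset.1 hj)

theorem exists_prod_eq [DecidableRel r] (H : IsExterior θ r φ X) (hr : ∀ i k, r i k → ¬ r k i)
    (ht : ∀ i j k, r i j → r j k → r i k) (htri : ∀ i k, i ≠ k → r i k ∨ r k i)
    {l : List (Fin n)} (hl : l.Nodup) :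
    ∃ l' : List (Fin n), l'.Pairwise r ∧ l'.Perm l ∧
      (l.map X).prod = φ (listCoeff θ r l) * (l'.map X).prod := by
  induction l with
  | nil => exact ⟨[], .nil, .refl _, by simp [listCoeff]⟩
  | cons i l ih =>
    rw [List.nodup_cons] at hl
    obtain ⟨l₁, h1, h2, h3⟩ := ih hl.2
    obtain ⟨l₂, h4, h5, h6⟩ := H.mul_prod_of_notMem hr ht htri h1 (mt h2.mem_iff.1 hl.1)
    refine ⟨l₂, h4, h5.trans (h2.cons i), ?_⟩
    rw [List.map_cons, List.prod_cons, h3, ← mul_assoc, H.commute, mul_assoc, h6,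
      List.toFinset_eq_of_perm _ _ h2, listCoeff, if_neg hl.1, ← mul_assoc, ← map_mul, mul_comm]
    exact shift_listCoeff (wt_apply_of_notMem hl.1)

theorem prod_eq_zero [DecidableRel r] (H : IsExterior θ r φ X) (hr : ∀ i k, r i k → ¬ r k i)
    (ht : ∀ i j k, r i j → r j k → r i k) (htri : ∀ i k, i ≠ k → r i k ∨ r k i)
    {l : List (Fin n)} (hl : ¬ l.Nodup) : (l.map X).prod = 0 := by
  induction l with
  | nil => exact absurd List.nodup_nil hl
  | cons i l ih =>
    rw [List.map_cons, List.prod_cons]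
    by_cases h : l.Nodup
    · have hi : i ∈ l := by
        by_contra hi
        exact hl (List.nodup_cons.2 ⟨hi, h⟩)
      obtain ⟨l', h1, h2, h3⟩ := H.exists_prod_eq hr ht htri h
      -- As `i` occurs in `l`, the coefficient need not be invariant under the shift by `wt i`. It
      -- is written as a shift so that it can be moved to the left of `X i`.
      have h4 := H.comm (Mer.shift (-wt i) (listCoeff θ r l)) i
      rw [Mer.shift_shift_neg] at h4
      rw [h3, ← mul_assoc, ← h4, mul_assoc, H.mul_prod_of_mem h1 (h2.mem_iff.2 hi), mul_zero]
    · rw [ih h, mul_zero]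

/-- The product of any list of generators, in terms of the ordered products. -/
theorem prod_eq [DecidableRel r] (H : IsExterior θ r φ X) (hr : ∀ i k, r i k → ¬ r k i)
    (ht : ∀ i j k, r i j → r j k → r i k) (htri : ∀ i k, i ≠ k → r i k ∨ r k i)
    (l l' : List (Fin n)) (hl' : l'.Pairwise r) (h : l.toFinset = l'.toFinset) :
    (l.map X).prod = φ (listCoeff θ r l) * (l'.map X).prod := by
  by_cases hl : l.Nodup
  · obtain ⟨l₁, h1, h2, h3⟩ := H.exists_prod_eq hr ht htri hl
    have hn : l'.Nodup := hl'.imp fun {a b} hab => by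
      rintro rfl
      exact hr _ _ hab hab
    rw [h3, List.Perm.eq_of_pairwise (le := r) (fun a b _ _ hab hba => absurd hba (hr _ _ hab))
      h1 hl' (h2.trans (List.perm_of_nodup_nodup_toFinset_eq hl hn h))]
  · rw [H.prod_eq_zero hr ht htri hl, listCoeff_eq_zero hl, map_zero, zero_mul]

end IsExterior

/-! ### A representation separating the ordered products -/

section Representation

variable (θ : ℂ) {n : ℕ} (r : Fin n → Fin n → Prop) [DecidableRel r]

/-- The meromorphic functions acting on the free module over the subsets by multiplication. -/
noncomputable def mulRep (n : ℕ) : Mer n →ₐ[ℂ] Module.End ℂ (Finset (Fin n) → Mer n) :=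
  Algebra.lsmul ℂ ℂ (Finset (Fin n) → Mer n)

theorem mulRep_apply (f : Mer n) (g : Finset (Fin n) → Mer n) (K : Finset (Fin n)) :
    mulRep n f g K = f * g K := rfl

/-- The `i`-th generator acting on the free module over the subsets. -/
noncomputable def genRep (i : Fin n) : Module.End ℂ (Finset (Fin n) → Mer n) :=
  LinearMap.pi fun K => if i ∈ K then
    LinearMap.mulLeft ℂ (∏ k ∈ K.erase i, swapCoeff θ r i k) ∘ₗ
      (Mer.shift (-wt i)).toLinearMap ∘ₗ LinearMap.proj (K.erase i) else 0

theorem genRep_apply (i : Fin n) (g : Finset (Fin n) → Mer n) (K : Finset (Fin n)) :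
    genRep θ r i g K = if i ∈ K then (∏ k ∈ K.erase i, swapCoeff θ r i k) *
      Mer.shift (-wt i) (g (K.erase i)) else 0 := by
  rw [genRep, LinearMap.pi_apply]
  split_ifs <;> rfl

/-- The operators are modelled on left multiplication on ordered products, with coefficients written
on the left. Since they satisfy the exterior relations, they extend to `W` and `V`, where no linear
independence of the ordered products is known beforehand. -/
theorem isExterior_genRep (hr : ∀ i k, r i k → ¬ r k i) :
    IsExterior θ r (mulRep n) (genRep θ r) where
  comm f i := by
    refine LinearMap.ext fun g => funext fun K => ?_
    simp only [Module.End.mul_apply, mulRep_apply, genRep_apply]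
    split_ifs
    · rw [map_mul, Mer.shift_neg_shift]
      ring
    · exact mul_zero _
  sq i := by
    refine LinearMap.ext fun g => funext fun K => ?_
    simp [Module.End.mul_apply, genRep_apply]
  anti i j hij := by
    have hne : i ≠ j := by
      rintro rfl
      exact hr _ _ hij hij
    refine LinearMap.ext fun g => funext fun K => ?_
    simp only [Module.End.mul_apply, LinearMap.neg_apply, Pi.neg_apply, mulRep_apply,
      genRep_apply, Finset.mem_erase, hne, hne.symm, Ne, not_false_eq_true, true_and]
    by_cases hi : i ∈ K <;> by_cases hj : j ∈ K <;> simp only [hi, hj, if_true, if_false,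
      map_zero, mul_zero, neg_zero]
    -- Only the case of both indices in `K` is left. The two orders of insertion differ in the
    -- factor of the pair {i, j} alone: it is -h(λ_j - λ_i) if `j` is inserted before `i` from the
    -- left, and 1 in the other order.
    have e1 : ∏ k ∈ K.erase j, swapCoeff θ r j k =
        -hFun θ j i * ∏ k ∈ (K.erase j).erase i, swapCoeff θ r j k := by
      rw [← Finset.mul_prod_erase (K.erase j) _ (Finset.mem_erase.2 ⟨hne, hi⟩), swapCoeff,
        if_pos hij]
    have e2 : ∏ k ∈ K.erase i, swapCoeff θ r i k =
        ∏ k ∈ (K.erase i).erase j, swapCoeff θ r i k := by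
      rw [← Finset.mul_prod_erase (K.erase i) _ (Finset.mem_erase.2 ⟨hne.symm, hj⟩), swapCoeff,
        if_neg (hr _ _ hij), one_mul]
    rw [e1, e2, map_mul, map_mul, shift_prod_swapCoeff, shift_prod_swapCoeff,
      Finset.erase_right_comm (a := j) (b := i), ← Mer.shift_add, ← Mer.shift_add,
      add_comm (-wt j)]
    · ring
    · intro k hk
      simp only [Finset.mem_erase] at hk
      simp [wt, hne, hk.2.1]
    · intro k hk
      simp only [Finset.mem_erase] at hk
      simp [wt, hne.symm, hk.2.1]

theorem genRep_single (i : Fin n) (I : Finset (Fin n)) (f : Mer n) :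
    genRep θ r i (Pi.single I f) = if i ∈ I then 0 else
      Pi.single (insert i I) ((∏ k ∈ I, swapCoeff θ r i k) * Mer.shift (-wt i) f) := by
  funext K
  rw [genRep_apply]
  by_cases hK : i ∈ K
  · rw [if_pos hK]
    by_cases hI : K.erase i = I
    · subst hI
      simp [Finset.insert_erase hK]
    · rw [Pi.single_eq_of_ne hI, map_zero, mul_zero]
      split_ifs with hi
      · rfl
      · rw [Pi.single_eq_of_ne]
        rintro rfl
        exact hI (Finset.erase_insert hi)
  · rw [if_neg hK]
    split_ifs with hi
    · rfl
    · rw [Pi.single_eq_of_ne]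
      rintro rfl
      exact hK (Finset.mem_insert_self _ _)

/-- Acting on the vacuum vector supported at ∅ makes the normal ordering coefficient of a word
visible as a coordinate. -/
theorem prod_genRep_single (l : List (Fin n)) :
    (l.map (genRep θ r)).prod (Pi.single ∅ 1) = Pi.single l.toFinset (listCoeff θ r l) := by
  induction l with
  | nil => rfl
  | cons i l ih =>
    rw [List.map_cons, List.prod_cons, Module.End.mul_apply, ih, genRep_single, listCoeff]
    by_cases hi : i ∈ l
    · simp [hi]
    · rw [if_neg (by simpa using hi), if_neg hi, List.toFinset_cons, shift_listCoeff]
      intro k hk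
      rw [Pi.neg_apply, wt_apply_of_notMem hi k hk, neg_zero]

end Representation

/-! ### Words and the sum over all arrangements of a set -/

section Arrangements

/-- The lists of length `m` with entries in a finite type. -/
def words (ι : Type*) [Fintype ι] [DecidableEq ι] : ℕ → Finset (List ι)
  | 0 => {[]}
  | m + 1 => (Finset.univ ×ˢ words ι m).image fun p => p.1 :: p.2

variable {ι : Type*} [Fintype ι] [DecidableEq ι]

theorem sum_words_zero {B : Type*} [AddCommMonoid B] (F : List ι → B) :
    ∑ l ∈ words ι 0, F l = F [] := Finset.sum_singleton _ _

theorem sum_words_succ {B : Type*} [AddCommMonoid B] (m : ℕ) (F : List ι → B) :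
    ∑ l ∈ words ι (m + 1), F l = ∑ i, ∑ l ∈ words ι m, F (i :: l) := by
  rw [words, Finset.sum_image, Finset.sum_product]
  rintro ⟨a, b⟩ - ⟨c, d⟩ - h
  simpa using h

theorem length_of_mem_words {m : ℕ} {l : List ι} (h : l ∈ words ι m) : l.length = m := by
  induction m generalizing l with
  | zero => simp_all [words]
  | succ m ih =>
    simp only [words, Finset.mem_image, Finset.mem_product, Finset.mem_univ, true_and] at h
    obtain ⟨p, hp, rfl⟩ := h
    rw [List.length_cons, ih hp]

end Arrangements

section ArrangementSum

variable {θ : ℂ} {n : ℕ}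

theorem swapCoeff_lt_mul_gt {i k : Fin n} (h : i ≠ k) :
    swapCoeff θ (· < ·) i k * swapCoeff θ (· > ·) i k = -hFun θ i k := by
  rcases lt_or_gt_of_ne h with h | h
  · simp [swapCoeff, h, h.le]
  · simp [swapCoeff, h, h.le]

/-- The value of the sum of the products of the two coefficients over all arrangements of a set
with `m` elements. -/
noncomputable def arrangementConst (θ : ℂ) : ℕ → ℂ
  | 0 => 1
  | m + 1 => (-1) ^ m * ((Complex.exp θ ^ (m + 1) - (Complex.exp θ)⁻¹ ^ (m + 1)) /
      (Complex.exp θ - (Complex.exp θ)⁻¹)) * arrangementConst θ m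

theorem pow_sub_inv_pow_ne_zero {x : ℂ} (hx : x ≠ 0) {k : ℕ} (h : x ^ (2 * k) ≠ 1) :
    x ^ k - x⁻¹ ^ k ≠ 0 := by
  intro h0
  apply h
  rw [sub_eq_zero, inv_pow] at h0
  rw [two_mul, pow_add]
  nth_rewrite 1 [h0]
  exact inv_mul_cancel₀ (pow_ne_zero _ hx)

theorem arrangementConst_ne_zero {m : ℕ}
    (h : ∀ k : ℕ, 1 ≤ k → k ≤ m → Complex.exp θ ^ (2 * k) ≠ 1) : arrangementConst θ m ≠ 0 := by
  induction m with
  | zero => exact one_ne_zero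
  | succ m ih =>
    have h1 := pow_sub_inv_pow_ne_zero (Complex.exp_ne_zero θ) (h 1 le_rfl (by lia))
    have h2 := pow_sub_inv_pow_ne_zero (Complex.exp_ne_zero θ) (h (m + 1) (by lia) le_rfl)
    rw [pow_one, pow_one] at h1
    exact mul_ne_zero (mul_ne_zero (pow_ne_zero _ (neg_ne_zero.2 one_ne_zero))
      (div_ne_zero h2 h1)) (ih fun k hk hk' => h k hk (by lia))

/-- This is `sum_prod_erase_div` at y_i = q^(-2λ_i) with parameters q and q⁻¹. What matters is that
the sum does not depend on λ. -/
theorem sum_prod_hFun (hθ : Complex.exp θ ^ 2 ≠ 1) (K : Finset (Fin n)) :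
    ∑ i ∈ K, ∏ k ∈ K.erase i, hFun θ i k = algebraMap ℂ (Mer n)
      ((Complex.exp θ ^ K.card - (Complex.exp θ)⁻¹ ^ K.card) /
        (Complex.exp θ - (Complex.exp θ)⁻¹)) := by
  have h1 := pow_sub_inv_pow_ne_zero (k := 1) (Complex.exp_ne_zero θ) (by simpa using hθ)
  rw [pow_one, pow_one] at h1
  have h2 : qConst θ n - (qConst θ n)⁻¹ ≠ 0 := by
    rw [qConst, ← map_inv₀, ← map_sub, Ne, map_eq_zero]
    exact h1
  have := sum_prod_erase_div K (qCoord θ) (qCoord_injective hθ).injOn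
    (fun i _ => qCoord_ne_zero θ i) (qConst θ n) (qConst θ n)⁻¹
  simp only [← hFun_eq] at this
  rw [map_div₀, map_sub, map_sub, map_pow, map_pow, map_inv₀, eq_div_iff, mul_comm]
  · exact this
  · exact h2

/-- Splitting off the first entry `i` of an arrangement leaves an arrangement of K \ {i} and the
factor ∏ (-h(λ_i - λ_k)), because each `k` contributes to exactly one of the two coefficients. By
induction the sum over the rest is a constant, and `sum_prod_hFun` evaluates the sum over `i`. The
condition on q is only asked for in the presence of an index, so that n = 0 is covered. -/
theorem sum_listCoeff_mul (hθ : Fin n → Complex.exp θ ^ 2 ≠ 1) (K : Finset (Fin n)) :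
    ∑ l ∈ words (Fin n) K.card with l.toFinset = K,
      listCoeff θ (· < ·) l * listCoeff θ (· > ·) l =
      algebraMap ℂ (Mer n) (arrangementConst θ K.card) := by
  induction hm : K.card generalizing K with
  | zero =>
    rw [Finset.card_eq_zero] at hm
    subst hm
    rw [Finset.sum_filter, sum_words_zero]
    simp [listCoeff, arrangementConst]
  | succ m ih =>
    rw [Finset.sum_filter, sum_words_succ, arrangementConst, map_mul, map_mul]
    obtain ⟨i₀, -⟩ := Finset.card_pos.1 (show 0 < K.card by lia)
    have hs := sum_prod_hFun (hθ i₀) K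
    rw [hm] at hs
    rw [← hs, ← Finset.sum_subset (Finset.subset_univ K), Finset.mul_sum, Finset.sum_mul]
    · refine Finset.sum_congr rfl fun i hi => ?_
      have hc : (K.erase i).card = m := by rw [Finset.card_erase_of_mem hi, hm]; rfl
      have hp : (-1) ^ m * ∏ k ∈ K.erase i, hFun θ i k =
          ∏ k ∈ K.erase i, swapCoeff θ (· < ·) i k * swapCoeff θ (· > ·) i k := by
        rw [← hc, ← Finset.prod_const, ← Finset.prod_mul_distrib]
        refine Finset.prod_congr rfl fun k hk => ?_
        rw [swapCoeff_lt_mul_gt (Finset.ne_of_mem_erase hk).symm, neg_one_mul]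
      rw [map_pow, map_neg, map_one, hp, ← ih (K.erase i) hc, Finset.sum_filter, Finset.mul_sum]
      refine Finset.sum_congr rfl fun l hl => ?_
      rw [List.toFinset_cons, listCoeff, listCoeff]
      by_cases hil : i ∈ l
      · have : l.toFinset ≠ K.erase i := by
          rintro h
          exact Finset.notMem_erase i K (h ▸ List.mem_toFinset.2 hil)
        simp [hil, this]
      · have : insert i l.toFinset = K ↔ l.toFinset = K.erase i := by
          constructor
          · rintro rfl
            rw [Finset.erase_insert (by simpa using hil)]
          · rintro h
            rw [h, Finset.insert_erase hi]
        simp only [hil, if_false, this]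
        split_ifs with h
        · rw [h, Finset.prod_mul_distrib]
          ring
        · rw [mul_zero]
    · intro i _ hi
      refine Finset.sum_eq_zero fun l _ => if_neg ?_
      rintro rfl
      exact hi (by simp)

end ArrangementSum

/-! ### Homogeneous parts and representatives in quotients -/

section GradedPiece

variable {A ι D : Type*} [Ring A] [Algebra ℂ A] [AddCommMonoid D] (gen : ι → A) (deg : ι → D)

theorem prod_mem_gradedPiece (l : List ι) :
    (l.map gen).prod ∈ gradedPiece gen deg (l.map deg).sum :=
  Submodule.subset_span ⟨l, rfl, rfl⟩

theorem gen_mem_gradedPiece (s : ι) : gen s ∈ gradedPiece gen deg (deg s) := by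
  simpa using prod_mem_gradedPiece gen deg [s]

theorem one_mem_gradedPiece : 1 ∈ gradedPiece gen deg 0 := by
  simpa using prod_mem_gradedPiece gen deg []

variable {gen deg}

theorem mul_mem_gradedPiece {d e : D} {a b : A} (ha : a ∈ gradedPiece gen deg d)
    (hb : b ∈ gradedPiece gen deg e) : a * b ∈ gradedPiece gen deg (d + e) := by
  have h := Submodule.mul_mem_mul ha hb
  rw [gradedPiece, gradedPiece, Submodule.span_mul_span] at h
  refine Submodule.span_mono ?_ h
  rintro _ ⟨_, ⟨l, rfl, rfl⟩, _, ⟨l', rfl, rfl⟩, rfl⟩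
  exact ⟨l ++ l', by simp, by simp⟩

theorem gradedPiece_comm {M : Type*} (φ : M → A) (act : D → M → M) (h0 : ∀ f, act 0 f = f)
    (hadd : ∀ d e f, act (d + e) f = act e (act d f))
    (hgen : ∀ f s, φ f * gen s = gen s * φ (act (deg s) f)) {d : D} {a : A}
    (ha : a ∈ gradedPiece gen deg d) (f : M) : φ f * a = a * φ (act d f) := by
  induction ha using Submodule.span_induction with
  | mem a h =>
    obtain ⟨l, rfl, rfl⟩ := h
    induction l generalizing f with
    | nil => simp [h0]
    | cons s l ih =>
      rw [List.map_cons, List.prod_cons, ← mul_assoc, hgen, mul_assoc, ih, List.map_cons,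
        List.sum_cons, hadd, mul_assoc]
  | zero => simp
  | add a b _ _ ha hb => rw [mul_add, add_mul, ha, hb]
  | smul c a _ ha => rw [mul_smul_comm, smul_mul_assoc, ha]

end GradedPiece

section Represents

variable {T : Type*} [Ring T] [Algebra ℂ T] {P : Subalgebra ℂ T} {r : P → P → Prop}

/-- The element `z` of a quotient of the subalgebra `P` is the class of `x`. -/
def Represents (z : (ringConGen r).Quotient) (x : T) : Prop :=
  ∃ p : P, (p : T) = x ∧ (p : (ringConGen r).Quotient) = z

namespace Represents

variable {z z' : (ringConGen r).Quotient} {x x' : T}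

theorem unique (h : Represents z x) (h' : Represents z' x) : z = z' := by
  obtain ⟨p, rfl, rfl⟩ := h
  obtain ⟨p', h, rfl⟩ := h'
  rw [Subtype.ext h]

theorem add (h : Represents z x) (h' : Represents z' x') : Represents (z + z') (x + x') := by
  obtain ⟨p, rfl, rfl⟩ := h
  obtain ⟨p', rfl, rfl⟩ := h'
  exact ⟨p + p', rfl, rfl⟩

theorem mul (h : Represents z x) (h' : Represents z' x') : Represents (z * z') (x * x') := by
  obtain ⟨p, rfl, rfl⟩ := h
  obtain ⟨p', rfl, rfl⟩ := h'
  exact ⟨p * p', rfl, rfl⟩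

theorem sub (h : Represents z x) (h' : Represents z' x') : Represents (z - z') (x - x') := by
  obtain ⟨p, rfl, rfl⟩ := h
  obtain ⟨p', rfl, rfl⟩ := h'
  exact ⟨p - p', rfl, rfl⟩

theorem smul (c : ℂ) (h : Represents z x) : Represents (c • z) (c • x) := by
  obtain ⟨p, rfl, rfl⟩ := h
  exact ⟨c • p, rfl, rfl⟩

theorem zero : Represents (0 : (ringConGen r).Quotient) 0 := ⟨0, rfl, rfl⟩

theorem one : Represents (1 : (ringConGen r).Quotient) 1 := ⟨1, rfl, rfl⟩

end Represents

end Represents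

/-! ### Dynamical tensor products -/

/-- A family of homogeneous parts of an algebra over the meromorphic functions. -/
structure GradedOver {n : ℕ} {E : Type*} [Ring E] [Algebra ℂ E] (φ : Mer n →ₐ[ℂ] E)
    (PE : (Fin n → ℂ) → Set E) : Prop where
  one_mem : 1 ∈ PE 0
  mul_mem : ∀ {α β a b}, a ∈ PE α → b ∈ PE β → a * b ∈ PE (α + β)
  fn_mem : ∀ f, φ f ∈ PE 0
  comm : ∀ {α a}, a ∈ PE α → ∀ f, φ f * a = a * φ (Mer.shift α f)

namespace GradedOver

variable {n : ℕ} {E : Type*} [Ring E] [Algebra ℂ E] {φ : Mer n →ₐ[ℂ] E}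
    {PE : (Fin n → ℂ) → Set E} {α : Fin n → ℂ} {a : E}

theorem fn_mul_mem (h : GradedOver φ PE) (ha : a ∈ PE α) (f : Mer n) : φ f * a ∈ PE α := by
  simpa using h.mul_mem (h.fn_mem f) ha

theorem comm' (h : GradedOver φ PE) (ha : a ∈ PE α) (f : Mer n) :
    a * φ f = φ (Mer.shift (-α) f) * a := by
  rw [h.comm ha, Mer.shift_shift_neg]

theorem list_prod_mem (h : GradedOver φ PE) {ι : Type*} (X : ι → E) (deg : ι → Fin n → ℂ)
    (hX : ∀ i, X i ∈ PE (deg i)) (l : List ι) : (l.map X).prod ∈ PE (l.map deg).sum := by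
  induction l with
  | nil => exact h.one_mem
  | cons i l ih => simpa using h.mul_mem (hX i) ih

end GradedOver

/-- A dynamical tensor product: the quotient of the subalgebra `P`, spanned by the `τ e a` with `e`
and `a` of the same degree, by the relations `τ (f e) a = τ e (f a)`. -/
structure DynTensor {n : ℕ} {E F T : Type*} [Ring E] [Algebra ℂ E] [Ring F] [Algebra ℂ F]
    [Ring T] [Algebra ℂ T] (φ : Mer n →ₐ[ℂ] E) (μ : Mer n →ₐ[ℂ] F) (PE : (Fin n → ℂ) → Set E)
    (PF : (Fin n → ℂ) → Set F) (τ : E →ₗ[ℂ] F →ₗ[ℂ] T) (P : Subalgebra ℂ T) (r : P → P → Prop) :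
    Prop where
  gradedE : GradedOver φ PE
  gradedF : GradedOver μ PF
  tmul_mul : ∀ e a e' a', τ e a * τ e' a' = τ (e * e') (a * a')
  tmul_one : τ 1 1 = 1
  lift : ∀ b : E →ₗ[ℂ] F →ₗ[ℂ] F, ∃ Φ : T →ₗ[ℂ] F, ∀ e a, Φ (τ e a) = b e a
  eq_adjoin : P = Algebra.adjoin ℂ {x | ∃ α e a, e ∈ PE α ∧ a ∈ PF α ∧ x = τ e a}
  rel : ∀ x y, r x y → ∃ α f e a, e ∈ PE α ∧ a ∈ PF α ∧
    ((x : T) = τ (φ f * e) a ∧ (y : T) = τ e (μ f * a) ∨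
      (y : T) = τ (φ f * e) a ∧ (x : T) = τ e (μ f * a))
  rel' : ∀ α f e a, e ∈ PE α → a ∈ PF α → ∀ x y : P,
    (x : T) = τ (φ f * e) a → (y : T) = τ e (μ f * a) → r x y ∨ r y x

/-- The span of the relations of a dynamical tensor product. -/
def balancing {n : ℕ} {E F T : Type*} [Ring E] [Algebra ℂ E] [Ring F] [Algebra ℂ F]
    [Ring T] [Algebra ℂ T] (φ : Mer n →ₐ[ℂ] E) (μ : Mer n →ₐ[ℂ] F) (PE : (Fin n → ℂ) → Set E)
    (PF : (Fin n → ℂ) → Set F) (τ : E →ₗ[ℂ] F →ₗ[ℂ] T) : Submodule ℂ T :=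
  Submodule.span ℂ {m | ∃ α f e a, e ∈ PE α ∧ a ∈ PF α ∧ m = τ (φ f * e) a - τ e (μ f * a)}

namespace DynTensor

variable {n : ℕ} {E F T : Type*} [Ring E] [Algebra ℂ E] [Ring F] [Algebra ℂ F]
    [Ring T] [Algebra ℂ T] {φ : Mer n →ₐ[ℂ] E} {μ : Mer n →ₐ[ℂ] F} {PE : (Fin n → ℂ) → Set E}
    {PF : (Fin n → ℂ) → Set F} {τ : E →ₗ[ℂ] F →ₗ[ℂ] T} {P : Subalgebra ℂ T} {r : P → P → Prop}

theorem tmul_mem (H : DynTensor φ μ PE PF τ P r) {α : Fin n → ℂ} {e : E} {a : F} (he : e ∈ PE α)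
    (ha : a ∈ PF α) : τ e a ∈ P := by
  rw [H.eq_adjoin]
  exact Algebra.subset_adjoin ⟨α, e, a, he, ha, rfl⟩

/-- In τ e a · τ (f e') a' the function f has to be moved past e, and in τ e a · τ e' (f a') past a.
Both moves shift f by the same amount because e and a have the same degree; this is what the
restriction to matching degrees is for. -/
theorem mul_mem_balancing (H : DynTensor φ μ PE PF τ P r) {u m : T} (hu : u ∈ P)
    (hm : m ∈ balancing φ μ PE PF τ) :
    u * m ∈ balancing φ μ PE PF τ ∧ m * u ∈ balancing φ μ PE PF τ := by
  rw [H.eq_adjoin] at hu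
  induction hu using Algebra.adjoin_induction generalizing m with
  | mem u h =>
    obtain ⟨α, e, a, he, ha, rfl⟩ := h
    induction hm using Submodule.span_induction with
    | mem m hm =>
      obtain ⟨β, f, e', a', he', ha', rfl⟩ := hm
      refine ⟨Submodule.subset_span ⟨_, Mer.shift (-α) f, _, _, H.gradedE.mul_mem he he',
        H.gradedF.mul_mem ha ha', ?_⟩, Submodule.subset_span ⟨_, f, _, _,
        H.gradedE.mul_mem he' he, H.gradedF.mul_mem ha' ha, ?_⟩⟩
      · rw [mul_sub, H.tmul_mul, H.tmul_mul, ← mul_assoc, ← mul_assoc, ← mul_assoc,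
          H.gradedE.comm' he, H.gradedF.comm' ha, mul_assoc (μ _)]
      · rw [sub_mul, H.tmul_mul, H.tmul_mul, mul_assoc, mul_assoc]
    | zero => simp
    | add x y _ _ hx hy =>
      rw [mul_add, add_mul]
      exact ⟨add_mem hx.1 hy.1, add_mem hx.2 hy.2⟩
    | smul c x _ hx =>
      rw [mul_smul_comm, smul_mul_assoc]
      exact ⟨Submodule.smul_mem _ _ hx.1, Submodule.smul_mem _ _ hx.2⟩
  | algebraMap c =>
    rw [← Algebra.commutes, and_self, ← Algebra.smul_def]
    exact Submodule.smul_mem _ _ hm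
  | add x y _ _ hx hy =>
    rw [mul_add, add_mul]
    exact ⟨add_mem (hx hm).1 (hy hm).1, add_mem (hx hm).2 (hy hm).2⟩
  | mul x y _ _ hx hy =>
    rw [mul_assoc, ← mul_assoc m]
    exact ⟨(hx (hy hm).1).1, (hy (hx hm).2).2⟩

/-- The congruence is generated by elements of the balancing span, and this span is stable under
multiplication by `P` on both sides. Hence passing to the generated ring congruence adds nothing,
and a linear map killing the span descends to the quotient. -/
theorem sub_mem_balancing (H : DynTensor φ μ PE PF τ P r) {z : (ringConGen r).Quotient} {x y : T}
    (hx : Represents z x) (hy : Represents z y) : x - y ∈ balancing φ μ PE PF τ := by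
  obtain ⟨p, rfl, rfl⟩ := hx
  obtain ⟨p', rfl, h⟩ := hy
  have h' : RingConGen.Rel r p p' := (RingCon.eq _).1 h.symm
  clear h
  induction h' with
  | of x y h =>
    obtain ⟨α, f, e, a, he, ha, h⟩ := H.rel _ _ h
    have hm : τ (φ f * e) a - τ e (μ f * a) ∈ balancing φ μ PE PF τ :=
      Submodule.subset_span ⟨α, f, e, a, he, ha, rfl⟩
    rcases h with h | h
    · rwa [h.1, h.2]
    · rw [h.1, h.2, ← neg_sub]
      exact neg_mem hm
  | refl => simp
  | symm _ ih => rw [← neg_sub]; exact neg_mem ih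
  | trans _ _ ih ih' => simpa using add_mem ih ih'
  | @add w x y z _ _ ih ih' =>
    rw [Subalgebra.coe_add, Subalgebra.coe_add, add_sub_add_comm]
    exact add_mem ih ih'
  | @mul w x y z _ _ ih ih' =>
    have : ((w * y : P) : T) - (x * z : P) = (w - x) * y + x * (y - z) := by
      rw [Subalgebra.coe_mul, Subalgebra.coe_mul]
      noncomm_ring
    rw [this]
    exact add_mem (H.mul_mem_balancing y.2 ih).2 (H.mul_mem_balancing x.2 ih').1

theorem represents_zero (H : DynTensor φ μ PE PF τ P r) {m : T}
    (hm : m ∈ balancing φ μ PE PF τ) : Represents (0 : (ringConGen r).Quotient) m := by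
  induction hm using Submodule.span_induction with
  | mem m h =>
    obtain ⟨α, f, e, a, he, ha, rfl⟩ := h
    let p : P := ⟨_, H.tmul_mem (H.gradedE.fn_mul_mem he f) ha⟩
    let p' : P := ⟨_, H.tmul_mem he (H.gradedF.fn_mul_mem ha f)⟩
    refine ⟨p - p', rfl, ?_⟩
    have h : (p : (ringConGen r).Quotient) = p' := by
      rcases H.rel' α f e a he ha p p' rfl rfl with h | h
      · exact (RingCon.eq _).2 (RingConGen.Rel.of _ _ h)
      · exact ((RingCon.eq _).2 (RingConGen.Rel.of _ _ h)).symm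
    exact (RingCon.coe_sub ..).trans (sub_eq_zero.2 h)
  | zero => exact .zero
  | add x y _ _ hx hy => simpa using hx.add hy
  | smul c x _ hx => simpa using hx.smul c

theorem represents_of_sub_mem (H : DynTensor φ μ PE PF τ P r) {z : (ringConGen r).Quotient}
    {x y : T} (hx : Represents z x) (h : x - y ∈ balancing φ μ PE PF τ) : Represents z y := by
  simpa using hx.sub (H.represents_zero h)

/-- In the applications `PF α` is a union over the second degree and not a subspace, so sums of its
elements need the relation for the span. -/
theorem tmul_sub_mem_of_mem_span {α : Fin n → ℂ} {e : E} {a : F} (he : e ∈ PE α)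
    (ha : a ∈ Submodule.span ℂ (PF α)) (f : Mer n) :
    τ (φ f * e) a - τ e (μ f * a) ∈ balancing φ μ PE PF τ := by
  induction ha using Submodule.span_induction with
  | mem a h => exact Submodule.subset_span ⟨α, f, e, a, he, h, rfl⟩
  | zero => simp
  | add a b _ _ ha hb =>
    rw [mul_add, map_add, map_add, add_sub_add_comm]
    exact add_mem ha hb
  | smul c a _ ha =>
    rw [mul_smul_comm, map_smul, map_smul, ← smul_sub]
    exact Submodule.smul_mem _ _ ha

/-- The maps `e ⊗ a ↦ c(e) a`, where `c` is a functional, are well defined on a dynamical tensor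
product. -/
theorem exists_functional (H : DynTensor φ μ PE PF τ P r) (c : E →ₗ[ℂ] Mer n)
    (hc : ∀ f e, c (φ f * e) = f * c e) :
    ∃ Φ : T →ₗ[ℂ] F, (∀ e a, Φ (τ e a) = μ (c e) * a) ∧ ∀ m ∈ balancing φ μ PE PF τ, Φ m = 0 := by
  obtain ⟨Φ, h⟩ := H.lift ((LinearMap.mul ℂ F) ∘ₗ μ.toLinearMap ∘ₗ c)
  have h' : ∀ e a, Φ (τ e a) = μ (c e) * a := h
  refine ⟨Φ, h', fun m hm => ?_⟩
  induction hm using Submodule.span_induction with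
  | mem m hm =>
    obtain ⟨α, f, e, a, -, -, rfl⟩ := hm
    rw [map_sub, h', h', hc, mul_comm f, map_mul, mul_assoc, sub_self]
  | zero => exact map_zero _
  | add x y _ _ hx hy => rw [map_add, hx, hy, add_zero]
  | smul c x _ hx => rw [map_smul, hx, smul_zero]

end DynTensor

/-- Twice the sum equals the sum of all G a c + G c a. This avoids splitting the double sum
according to the order of the indices. -/
theorem sum_sum_mem_of_add_swap_mem {ι V : Type*} [Fintype ι] [AddCommGroup V] [Module ℂ V]
    (N : Submodule ℂ V) (G : ι → ι → V) (h : ∀ a c, G a c + G c a ∈ N) :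
    ∑ a, ∑ c, G a c ∈ N := by
  have h1 : (2 : ℂ) • ∑ a, ∑ c, G a c ∈ N := by
    rw [two_smul]
    nth_rewrite 2 [Finset.sum_comm]
    simp only [← Finset.sum_add_distrib]
    exact sum_mem fun a _ => sum_mem fun c _ => h a c
  have h2 := N.smul_mem (2⁻¹ : ℂ) h1
  rwa [smul_smul, inv_mul_cancel₀ two_ne_zero, one_smul] at h2

/-! ### Exterior coactions and their matrix elements -/

/-- The product of the entries `t_{p_k l_k}` for two words `p` and `l`. -/
def wordProd {ι F : Type*} [Monoid F] (t : ι → ι → F) (p l : List ι) : F :=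
  (List.zipWith t p l).prod

theorem wordProd_swap {ι F : Type*} [Monoid F] (t : ι → ι → F) (p l : List ι) :
    wordProd (fun i j => t j i) p l = wordProd t l p := by
  rw [wordProd, wordProd, List.zipWith_comm]

/-- The conditions under which `X i ↦ ∑ j, X j ⊗ t j i`, `f ↦ 1 ⊗ ν f` defines a homomorphism from a
dynamical exterior algebra to a dynamical tensor product. -/
structure ExteriorCoaction (θ : ℂ) {n : ℕ} (lt : Fin n → Fin n → Prop) {E F : Type*} [Ring E]
    [Algebra ℂ E] [Ring F] [Algebra ℂ F] (φ : Mer n →ₐ[ℂ] E) (μ ν : Mer n →ₐ[ℂ] F)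
    (PE : (Fin n → ℂ) → Set E) (PF : (Fin n → ℂ) → Set F) (X : Fin n → E)
    (t : Fin n → Fin n → F) : Prop where
  exterior : IsExterior θ lt φ X
  gen_mem : ∀ i, X i ∈ PE (wt i)
  coeff_mem : ∀ j i, t j i ∈ PF (wt j)
  nu_mem : ∀ f, ν f ∈ PF 0
  nu_comm : ∀ f j i, ν f * t j i = t j i * ν (Mer.shift (wt i) f)
  sq : ∀ a c i, lt a c → t a i * t c i = μ (hFun θ c a) * (t c i * t a i)
  anti : ∀ a c i j, lt i j → lt a c → t a j * t c i + ν (hFun θ j i) * (t a i * t c j) =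
    μ (hFun θ c a) * (t c j * t a i + ν (hFun θ j i) * (t c i * t a j))

/-- A strict total order. -/
structure IsStrictTotal {ι : Type*} (lt : ι → ι → Prop) : Prop where
  asymm : ∀ i k, lt i k → ¬ lt k i
  trans : ∀ i j k, lt i j → lt j k → lt i k
  total : ∀ i k, i ≠ k → lt i k ∨ lt k i

/-- The matrix element `ξ^I_J`, as a sum over the arrangements of `I`. -/
noncomputable def minor (θ : ℂ) {n : ℕ} (lt : Fin n → Fin n → Prop) [DecidableRel lt] {F : Type*}
    [Ring F] [Algebra ℂ F] (μ : Mer n →ₐ[ℂ] F) (t : Fin n → Fin n → F) (I : Finset (Fin n))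
    (l : List (Fin n)) : F :=
  ∑ p ∈ words (Fin n) l.length with p.toFinset = I, μ (listCoeff θ lt p) * wordProd t p l

namespace ExteriorCoaction

variable {θ : ℂ} {n : ℕ} {lt : Fin n → Fin n → Prop} {E F T : Type*} [Ring E] [Algebra ℂ E]
    [Ring F] [Algebra ℂ F] [Ring T] [Algebra ℂ T] {φ : Mer n →ₐ[ℂ] E} {μ ν : Mer n →ₐ[ℂ] F}
    {PE : (Fin n → ℂ) → Set E} {PF : (Fin n → ℂ) → Set F} {τ : E →ₗ[ℂ] F →ₗ[ℂ] T}
    {P : Subalgebra ℂ T} {r : P → P → Prop} {X : Fin n → E} {t : Fin n → Fin n → F}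

theorem wordProd_mem (C : ExteriorCoaction θ lt φ μ ν PE PF X t) (hF : GradedOver μ PF)
    {p l : List (Fin n)} (h : p.length = l.length) : wordProd t p l ∈ PF (p.map wt).sum := by
  induction p generalizing l with
  | nil => simpa [wordProd] using hF.one_mem
  | cons i p ih =>
    cases l with
    | nil => simp at h
    | cons j l => simpa [wordProd] using hF.mul_mem (C.coeff_mem i j) (ih (by simpa using h))

/-- The diagonal terms vanish. For `lt a c`, X_c X_a ⊗ B_ca = -h X_a X_c ⊗ B_ca ≡ -X_a X_c ⊗ h B_ca
= -X_a X_c ⊗ B_ac with h = h(λ_c - λ_a), so the off-diagonal terms cancel in pairs. -/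
theorem sum_sum_mem_balancing (C : ExteriorCoaction θ lt φ μ ν PE PF X t)
    (H : DynTensor φ μ PE PF τ P r) (hlt : IsStrictTotal lt) (B : Fin n → Fin n → F)
    (hB : ∀ a c, B a c ∈ Submodule.span ℂ (PF (wt a + wt c)))
    (h : ∀ a c, lt a c → B a c = μ (hFun θ c a) * B c a) :
    ∑ a, ∑ c, τ (X a * X c) (B a c) ∈ balancing φ μ PE PF τ := by
  have key : ∀ a c, lt a c → τ (X a * X c) (B a c) + τ (X c * X a) (B c a) ∈
      balancing φ μ PE PF τ := by
    intro a c hac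
    have := DynTensor.tmul_sub_mem_of_mem_span (φ := φ) (μ := μ) (τ := τ) (H.gradedE.mul_mem (C.gen_mem a) (C.gen_mem c))
      (by rw [add_comm]; exact hB c a) (hFun θ c a)
    rw [C.exterior.anti a c hac, h a c hac, map_neg, LinearMap.neg_apply, ← sub_eq_add_neg,
      ← neg_sub, mul_assoc]
    exact neg_mem this
  refine sum_sum_mem_of_add_swap_mem _ _ fun a c => ?_
  by_cases hac : a = c
  · subst hac
    simp [C.exterior.sq]
  · rcases hlt.total a c hac with h' | h'
    · exact key a c h'
    · rw [add_comm]
      exact key c a h'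

/-- The square and anticommutation relations each expand to a double sum ∑ X_a X_c ⊗ B_ac, to which
`sum_sum_mem_balancing` applies; its condition on B is exactly `sq` or `anti` of the coaction. The
remaining relation only needs `nu_comm`. -/
theorem exists_isExterior (C : ExteriorCoaction θ lt φ μ ν PE PF X t)
    (H : DynTensor φ μ PE PF τ P r) (hlt : IsStrictTotal lt) :
    ∃ (ψ : Mer n →ₐ[ℂ] (ringConGen r).Quotient) (Y : Fin n → (ringConGen r).Quotient),
      IsExterior θ lt ψ Y ∧ (∀ f, Represents (ψ f) (τ 1 (ν f))) ∧
      ∀ i, Represents (Y i) (∑ j, τ (X j) (t j i)) := by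
  let ψT : Mer n →ₐ[ℂ] T := AlgHom.ofLinearMap (τ 1 ∘ₗ ν.toLinearMap) (by simp [H.tmul_one])
    (fun f g => by simp [H.tmul_mul])
  let ψP : Mer n →ₐ[ℂ] P := ψT.codRestrict P fun f => H.tmul_mem H.gradedE.one_mem (C.nu_mem f)
  let ψ : Mer n →ₐ[ℂ] (ringConGen r).Quotient := (RingCon.mkₐ ℂ (ringConGen r)).comp ψP
  let y : Fin n → P := fun i => ⟨∑ j, τ (X j) (t j i),
    sum_mem fun j _ => H.tmul_mem (C.gen_mem j) (C.coeff_mem j i)⟩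
  let Y : Fin n → (ringConGen r).Quotient := fun i => (y i : (ringConGen r).Quotient)
  have hψ : ∀ f, Represents (ψ f) (τ 1 (ν f)) := fun f => ⟨ψP f, rfl, rfl⟩
  have hY : ∀ i, Represents (Y i) (∑ j, τ (X j) (t j i)) := fun i => ⟨y i, rfl, rfl⟩
  have hYY : ∀ i j, Represents (Y i * Y j) (∑ a, ∑ c, τ (X a * X c) (t a i * t c j)) := by
    intro i j
    simpa only [Finset.sum_mul_sum, H.tmul_mul] using (hY i).mul (hY j)
  have hψYY : ∀ f i j, Represents (ψ f * Y i * Y j)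
      (∑ a, ∑ c, τ (X a * X c) (ν f * (t a i * t c j))) := by
    intro f i j
    simpa only [mul_assoc, Finset.mul_sum, H.tmul_mul, one_mul] using (hψ f).mul (hYY i j)
  refine ⟨ψ, Y, ⟨fun f i => ?_, fun i => ?_, fun i j hij => ?_⟩, hψ, hY⟩
  · refine Represents.unique (x := ∑ j, τ (X j) (ν f * t j i)) ?_ ?_
    · simpa only [Finset.mul_sum, H.tmul_mul, one_mul] using (hψ f).mul (hY i)
    · simpa only [Finset.sum_mul, H.tmul_mul, mul_one, ← C.nu_comm] using
        (hY i).mul (hψ (Mer.shift (wt i) f))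
  · refine (hYY i i).unique (H.represents_zero ?_)
    refine C.sum_sum_mem_balancing H hlt _ (fun a c => Submodule.subset_span ?_)
      fun a c hac => C.sq a c i hac
    exact H.gradedF.mul_mem (C.coeff_mem a i) (C.coeff_mem c i)
  · rw [← add_eq_zero_iff_eq_neg]
    have h := (hYY j i).add (hψYY (hFun θ j i) i j)
    simp only [← Finset.sum_add_distrib, ← map_add] at h
    refine h.unique (H.represents_zero ?_)
    refine C.sum_sum_mem_balancing H hlt _ (fun a c => add_mem (Submodule.subset_span ?_)
      (Submodule.subset_span ?_)) fun a c hac => C.anti a c i j hij hac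
    · exact H.gradedF.mul_mem (C.coeff_mem a j) (C.coeff_mem c i)
    · have := H.gradedF.mul_mem (C.nu_mem (hFun θ j i))
        (H.gradedF.mul_mem (C.coeff_mem a i) (C.coeff_mem c j))
      rwa [zero_add] at this

variable {R : E →ₐ[ℂ] (ringConGen r).Quotient}

theorem represents_prod (H : DynTensor φ μ PE PF τ P r)
    (hR : ∀ i, Represents (R (X i)) (∑ j, τ (X j) (t j i))) (l : List (Fin n)) :
    Represents (R (l.map X).prod)
      (∑ p ∈ words (Fin n) l.length, τ (p.map X).prod (wordProd t p l)) := by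
  induction l with
  | nil =>
    rw [List.length_nil, sum_words_zero, List.map_nil, List.prod_nil, map_one]
    simpa [wordProd, H.tmul_one] using Represents.one
  | cons i l ih =>
    rw [List.map_cons, List.prod_cons, map_mul, List.length_cons, sum_words_succ]
    simpa only [Finset.sum_mul_sum, H.tmul_mul, wordProd, List.map_cons, List.prod_cons,
      List.zipWith_cons_cons] using (hR i).mul ih

/-- Each word is brought into order, its coefficient is moved across the tensor sign, and the words
are grouped by their sets of letters. Words with a repeated letter contribute zero to both sums. -/
theorem sum_sub_sum_mem_balancing [DecidableRel lt] (C : ExteriorCoaction θ lt φ μ ν PE PF X t)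
    (H : DynTensor φ μ PE PF τ P r) (hlt : IsStrictTotal lt) (xs : Finset (Fin n) → List (Fin n))
    (hxs : ∀ I, (xs I).Pairwise lt ∧ (xs I).toFinset = I) (l : List (Fin n)) :
    ∑ p ∈ words (Fin n) l.length, τ (p.map X).prod (wordProd t p l) -
      ∑ I with I.card = l.length, τ ((xs I).map X).prod (minor θ lt μ t I l) ∈
      balancing φ μ PE PF τ := by
  have h1 : ∑ I with I.card = l.length, τ ((xs I).map X).prod (minor θ lt μ t I l) =
      ∑ p ∈ words (Fin n) l.length, τ ((xs p.toFinset).map X).prod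
        (μ (listCoeff θ lt p) * wordProd t p l) := by
    have h2 : ∀ I : Finset (Fin n), τ ((xs I).map X).prod (minor θ lt μ t I l) =
        ∑ p ∈ words (Fin n) l.length, if p.toFinset = I then
          τ ((xs p.toFinset).map X).prod (μ (listCoeff θ lt p) * wordProd t p l) else 0 := by
      intro I
      rw [minor, map_sum, Finset.sum_filter]
      refine Finset.sum_congr rfl fun p _ => ?_
      split_ifs with h
      · rw [h]
      · rfl
    simp only [h2]
    rw [Finset.sum_comm]
    refine Finset.sum_congr rfl fun p hp => ?_
    rw [Finset.sum_ite_eq]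
    -- A word whose set of letters has fewer than `l.length` elements repeats a letter, so its
    -- coefficient is zero.
    refine ite_eq_left_iff.2 fun h => ?_
    rw [listCoeff_eq_zero fun hn => h ?_]
    · simp
    · rw [Finset.mem_filter_univ, List.toFinset_card_of_nodup hn, length_of_mem_words hp]
  rw [h1, ← Finset.sum_sub_distrib]
  refine sum_mem fun p hp => ?_
  have hlen := length_of_mem_words hp
  by_cases hn : p.Nodup
  · rw [C.exterior.prod_eq hlt.asymm hlt.trans hlt.total p (xs p.toFinset) (hxs _).1
      (hxs _).2.symm]
    refine Submodule.subset_span ⟨(p.map wt).sum, _, _, _, ?_, C.wordProd_mem H.gradedF hlen, rfl⟩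
    have hperm : (xs p.toFinset).Perm p := by
      refine List.perm_of_nodup_nodup_toFinset_eq ?_ hn (hxs _).2
      refine (hxs _).1.imp fun {a b} hab => ?_
      rintro rfl
      exact hlt.asymm _ _ hab hab
    rw [← (hperm.map wt).sum_eq]
    exact H.gradedE.list_prod_mem X wt C.gen_mem _
  · rw [C.exterior.prod_eq_zero hlt.asymm hlt.trans hlt.total hn, listCoeff_eq_zero hn]
    simp

/-- The matrix elements exist. -/
theorem represents_minor [DecidableRel lt] (C : ExteriorCoaction θ lt φ μ ν PE PF X t)
    (H : DynTensor φ μ PE PF τ P r) (hlt : IsStrictTotal lt) (xs : Finset (Fin n) → List (Fin n))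
    (hxs : ∀ I, (xs I).Pairwise lt ∧ (xs I).toFinset = I)
    (hR : ∀ i, Represents (R (X i)) (∑ j, τ (X j) (t j i))) (l : List (Fin n)) :
    Represents (R (l.map X).prod)
      (∑ I with I.card = l.length, τ ((xs I).map X).prod (minor θ lt μ t I l)) :=
  H.represents_of_sub_mem (represents_prod H hR l) (C.sum_sub_sum_mem_balancing H hlt xs hxs l)

/-- The expressions for the matrix elements, one for every arrangement of the column indices. -/
theorem minor_eq [DecidableRel lt] (C : ExteriorCoaction θ lt φ μ ν PE PF X t)
    (H : DynTensor φ μ PE PF τ P r) (hlt : IsStrictTotal lt) (xs : Finset (Fin n) → List (Fin n))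
    (hxs : ∀ I, (xs I).Pairwise lt ∧ (xs I).toFinset = I)
    (hc : ∀ I, ∃ c : E →ₗ[ℂ] Mer n, (∀ f e, c (φ f * e) = f * c e) ∧
      ∀ p : List (Fin n), c (p.map X).prod = if p.toFinset = I then listCoeff θ lt p else 0)
    (hRf : ∀ f, Represents (R (φ f)) (τ 1 (ν f)))
    (hR : ∀ i, Represents (R (X i)) (∑ j, τ (X j) (t j i))) {J : Finset (Fin n)}
    {ξ : Finset (Fin n) → F} (hξ : Represents (R ((xs J).map X).prod)
      (∑ I with I.card = J.card, τ ((xs I).map X).prod (ξ I)))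
    {I : Finset (Fin n)} (hI : I.card = J.card) {l : List (Fin n)} (hl : l.toFinset = J) :
    minor θ lt μ t I l = ν (listCoeff θ lt l) * ξ I := by
  obtain ⟨c, hc1, hc2⟩ := hc I
  obtain ⟨Φ, hΦ, hΦ0⟩ := H.exists_functional c hc1
  -- R(X_l) has two representatives: the expansion over all words, and the one from X_l = c(l) X_J.
  -- The functional extracting the coefficient of X_I takes the same value on both.
  have h1 := represents_prod H hR l
  have h2 := (hRf (listCoeff θ lt l)).mul hξ
  rw [← map_mul, ← C.exterior.prod_eq hlt.asymm hlt.trans hlt.total l (xs J) (hxs J).1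
    (hl.trans (hxs J).2.symm)] at h2
  have h3 := hΦ0 _ (H.sub_mem_balancing h1 h2)
  rw [map_sub, sub_eq_zero] at h3
  simp only [Finset.mul_sum, H.tmul_mul, one_mul, map_sum, hΦ, hc2] at h3
  have h4 : ∀ K, listCoeff θ lt (xs K) = 1 := fun K => listCoeff_of_pairwise hlt.asymm (hxs K).1
  simp only [(hxs _).2, h4] at h3
  rw [minor, Finset.sum_filter]
  refine Eq.trans (Finset.sum_congr rfl fun p _ => ?_) (h3.trans ?_)
  · split_ifs <;> simp
  · rw [Finset.sum_eq_single I]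
    · simp
    · intro K _ hK
      simp [hK]
    · intro h
      exact absurd (by simpa using hI) h

end ExteriorCoaction

/-! ### The algebras W and V -/

section ExteriorAlgebras

variable (θ : ℂ) (n : ℕ)

/-- The copy of the meromorphic functions inside `W`. -/
noncomputable def wFn : Mer n →ₐ[ℂ] WAlg θ n where
  toFun f := wGen θ (.fn f)
  map_one' := (RingQuot.mkAlgHom_rel ℂ (WRel.fn_const (θ := θ) (n := n) 1)).trans (by simp)
  map_zero' := by
    have := RingQuot.mkAlgHom_rel ℂ (WRel.fn_const (θ := θ) (n := n) 0)
    rw [map_zero, map_zero, map_zero] at this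
    exact this
  map_mul' f g := (RingQuot.mkAlgHom_rel ℂ (WRel.fn_mul f g)).trans (map_mul _ _ _)
  map_add' f g := (RingQuot.mkAlgHom_rel ℂ (WRel.fn_add f g)).trans (map_add _ _ _)
  commutes' c := (RingQuot.mkAlgHom_rel ℂ (WRel.fn_const c)).trans (AlgHom.commutes _ c)

/-- The copy of the meromorphic functions inside `V`. -/
noncomputable def vFn : Mer n →ₐ[ℂ] VAlg θ n where
  toFun f := vGen θ (.fn f)
  map_one' := (RingQuot.mkAlgHom_rel ℂ (VRel.fn_const (θ := θ) (n := n) 1)).trans (by simp)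
  map_zero' := by
    have := RingQuot.mkAlgHom_rel ℂ (VRel.fn_const (θ := θ) (n := n) 0)
    rw [map_zero, map_zero, map_zero] at this
    exact this
  map_mul' f g := (RingQuot.mkAlgHom_rel ℂ (VRel.fn_mul f g)).trans (map_mul _ _ _)
  map_add' f g := (RingQuot.mkAlgHom_rel ℂ (VRel.fn_add f g)).trans (map_add _ _ _)
  commutes' c := (RingQuot.mkAlgHom_rel ℂ (VRel.fn_const c)).trans (AlgHom.commutes _ c)

theorem isExterior_W : IsExterior θ (· < ·) (wFn θ n) fun i => wGen θ (.e i) where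
  comm f i := by
    simpa only [map_mul] using! RingQuot.mkAlgHom_rel ℂ (WRel.fn_e (θ := θ) f i)
  sq i := by
    simpa only [map_mul, map_zero] using! RingQuot.mkAlgHom_rel ℂ (WRel.sq (θ := θ) i)
  anti i j hij := by
    simpa only [map_mul, map_neg] using! RingQuot.mkAlgHom_rel ℂ (WRel.anti (θ := θ) i j hij)

theorem isExterior_V : IsExterior θ (· > ·) (vFn θ n) fun i => vGen θ (.e i) where
  comm f i := by
    simpa only [map_mul] using! RingQuot.mkAlgHom_rel ℂ (VRel.fn_e (θ := θ) f i)
  sq i := by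
    simpa only [map_mul, map_zero] using! RingQuot.mkAlgHom_rel ℂ (VRel.sq (θ := θ) i)
  anti i j hij := by
    simpa only [map_mul, map_neg] using! RingQuot.mkAlgHom_rel ℂ (VRel.anti (θ := θ) j i hij)

variable {θ n} {A : Type*} [Ring A] [Algebra ℂ A] {ψ : Mer n →ₐ[ℂ] A} {Y : Fin n → A}

theorem IsExterior.exists_lift_W (H : IsExterior θ (· < ·) ψ Y) :
    ∃ R : WAlg θ n →ₐ[ℂ] A, (∀ f, R (wFn θ n f) = ψ f) ∧ ∀ i, R (wGen θ (.e i)) = Y i := by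
  let g : EGen n → A := fun s => match s with
    | .fn f => ψ f
    | .e i => Y i
  have hg : ∀ ⦃x y⦄, WRel θ n x y → FreeAlgebra.lift ℂ g x = FreeAlgebra.lift ℂ g y := by
    intro x y h
    induction h with
    | fn_e f i => simpa [g, Mer.shift_apply] using H.comm f i
    | sq i => simpa [g] using H.sq i
    | anti i j hij => simpa [g] using H.anti i j hij
    | _ => simp [g]
  refine ⟨RingQuot.liftAlgHom ℂ ⟨FreeAlgebra.lift ℂ g, hg⟩, fun f => ?_, fun i => ?_⟩
  · exact (RingQuot.liftAlgHom_mkAlgHom_apply ..).trans (FreeAlgebra.lift_ι_apply ..)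
  · exact (RingQuot.liftAlgHom_mkAlgHom_apply ..).trans (FreeAlgebra.lift_ι_apply ..)

theorem IsExterior.exists_lift_V (H : IsExterior θ (· > ·) ψ Y) :
    ∃ R : VAlg θ n →ₐ[ℂ] A, (∀ f, R (vFn θ n f) = ψ f) ∧ ∀ i, R (vGen θ (.e i)) = Y i := by
  let g : EGen n → A := fun s => match s with
    | .fn f => ψ f
    | .e i => Y i
  have hg : ∀ ⦃x y⦄, VRel θ n x y → FreeAlgebra.lift ℂ g x = FreeAlgebra.lift ℂ g y := by
    intro x y h
    induction h with
    | fn_e f i => simpa [g, Mer.shift_apply] using H.comm f i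
    | sq i => simpa [g] using H.sq i
    | anti i j hij => simpa [g] using H.anti j i hij
    | _ => simp [g]
  refine ⟨RingQuot.liftAlgHom ℂ ⟨FreeAlgebra.lift ℂ g, hg⟩, fun f => ?_, fun i => ?_⟩
  · exact (RingQuot.liftAlgHom_mkAlgHom_apply ..).trans (FreeAlgebra.lift_ι_apply ..)
  · exact (RingQuot.liftAlgHom_mkAlgHom_apply ..).trans (FreeAlgebra.lift_ι_apply ..)

theorem hom_ext_W {B : Type*} [Semiring B] [Algebra ℂ B] {R R' : WAlg θ n →ₐ[ℂ] B}
    (h : ∀ s, R (wGen θ s) = R' (wGen θ s)) : R = R' := by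
  apply RingQuot.ringQuot_ext' ℂ
  exact FreeAlgebra.hom_ext (funext h)

theorem hom_ext_V {B : Type*} [Semiring B] [Algebra ℂ B] {R R' : VAlg θ n →ₐ[ℂ] B}
    (h : ∀ s, R (vGen θ s) = R' (vGen θ s)) : R = R' := by
  apply RingQuot.ringQuot_ext' ℂ
  exact FreeAlgebra.hom_ext (funext h)

theorem isStrictTotal_lt : IsStrictTotal (fun i k : Fin n => i < k) :=
  ⟨fun _ _ h => h.asymm, fun _ _ _ h h' => h.trans h', fun _ _ h => lt_or_gt_of_ne h⟩

theorem isStrictTotal_gt : IsStrictTotal (fun i k : Fin n => i > k) :=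
  ⟨fun _ _ h => lt_asymm h, fun _ _ _ h h' => lt_trans h' h, fun _ _ h => lt_or_gt_of_ne h.symm⟩

/-- A homomorphism to the endomorphisms of the free module over the subsets yields the coefficient
functionals of a dynamical exterior algebra. -/
theorem exists_coeff {r : Fin n → Fin n → Prop} [DecidableRel r] {φ : Mer n →ₐ[ℂ] A}
    {X : Fin n → A} (h : ∃ ρ : A →ₐ[ℂ] Module.End ℂ (Finset (Fin n) → Mer n),
      (∀ f, ρ (φ f) = mulRep n f) ∧ ∀ i, ρ (X i) = genRep θ r i) (I : Finset (Fin n)) :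
    ∃ c : A →ₗ[ℂ] Mer n, (∀ f e, c (φ f * e) = f * c e) ∧
      ∀ p : List (Fin n), c (p.map X).prod = if p.toFinset = I then listCoeff θ r p else 0 := by
  obtain ⟨ρ, h1, h2⟩ := h
  -- The functional lets an element act on the vacuum vector and takes the coordinate at `I`.
  refine ⟨LinearMap.proj I ∘ₗ LinearMap.applyₗ (Pi.single ∅ 1) ∘ₗ ρ.toLinearMap,
    fun f e => ?_, fun p => ?_⟩
  · simp [h1, mulRep_apply]
  · have : ρ (p.map X).prod (Pi.single ∅ 1) = Pi.single p.toFinset (listCoeff θ r p) := by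
      rw [← prod_genRep_single, map_list_prod, List.map_map]
      congr 2
      exact List.map_congr_left fun i _ => h2 i
    change ρ (p.map X).prod (Pi.single ∅ 1) I = _
    rw [this, Pi.single_apply]
    simp only [eq_comm]

theorem gradedOver_W : GradedOver (wFn θ n) fun α => (WAlg.piece θ α : Set (WAlg θ n)) where
  one_mem := one_mem_gradedPiece _ _
  mul_mem := mul_mem_gradedPiece
  fn_mem f := gen_mem_gradedPiece (wGen θ) EGen.deg (.fn f)
  comm ha f := by
    refine gradedPiece_comm (wFn θ n) (fun α => Mer.shift α) Mer.shift_zero Mer.shift_add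
      (fun f s => ?_) ha f
    cases s with
    | fn g =>
      change wFn θ n f * wFn θ n g = wFn θ n g * wFn θ n (Mer.shift 0 f)
      rw [Mer.shift_zero, ← map_mul, mul_comm, map_mul]
    | e i => exact (isExterior_W θ n).comm f i

theorem gradedOver_V : GradedOver (vFn θ n) fun α => (VAlg.piece θ α : Set (VAlg θ n)) where
  one_mem := one_mem_gradedPiece _ _
  mul_mem := mul_mem_gradedPiece
  fn_mem f := gen_mem_gradedPiece (vGen θ) EGen.deg (.fn f)
  comm ha f := by
    refine gradedPiece_comm (vFn θ n) (fun α => Mer.shift α) Mer.shift_zero Mer.shift_add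
      (fun f s => ?_) ha f
    cases s with
    | fn g =>
      change vFn θ n f * vFn θ n g = vFn θ n g * vFn θ n (Mer.shift 0 f)
      rw [Mer.shift_zero, ← map_mul, mul_comm, map_mul]
    | e i => exact (isExterior_V θ n).comm f i

end ExteriorAlgebras

/-! ### The algebra F_R(M(n)) and the quadratic relations from RLL -/

section FRST

variable (θ : ℂ) (n : ℕ)

/-- The left moment map as a homomorphism. -/
noncomputable def lMom : Mer n →ₐ[ℂ] FAlg θ n where
  toFun f := muL θ f
  map_one' := (RingQuot.mkAlgHom_rel ℂ (FRel.lam_const (θ := θ) (n := n) 1)).trans (by simp)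
  map_zero' := by
    have := RingQuot.mkAlgHom_rel ℂ (FRel.lam_const (θ := θ) (n := n) 0)
    rw [map_zero, map_zero, map_zero] at this
    exact this
  map_mul' f g := (RingQuot.mkAlgHom_rel ℂ (FRel.lam_mul f g)).trans (map_mul _ _ _)
  map_add' f g := (RingQuot.mkAlgHom_rel ℂ (FRel.lam_add f g)).trans (map_add _ _ _)
  commutes' c := (RingQuot.mkAlgHom_rel ℂ (FRel.lam_const c)).trans (AlgHom.commutes _ c)

/-- The right moment map as a homomorphism. -/
noncomputable def rMom : Mer n →ₐ[ℂ] FAlg θ n where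
  toFun f := muR θ f
  map_one' := (RingQuot.mkAlgHom_rel ℂ (FRel.mu_const (θ := θ) (n := n) 1)).trans (by simp)
  map_zero' := by
    have := RingQuot.mkAlgHom_rel ℂ (FRel.mu_const (θ := θ) (n := n) 0)
    rw [map_zero, map_zero, map_zero] at this
    exact this
  map_mul' f g := (RingQuot.mkAlgHom_rel ℂ (FRel.mu_mul f g)).trans (map_mul _ _ _)
  map_add' f g := (RingQuot.mkAlgHom_rel ℂ (FRel.mu_add f g)).trans (map_add _ _ _)
  commutes' c := (RingQuot.mkAlgHom_rel ℂ (FRel.mu_const c)).trans (AlgHom.commutes _ c)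

variable {θ n}

theorem lMom_comm_rMom (f g : Mer n) : lMom θ n f * rMom θ n g = rMom θ n g * lMom θ n f := by
  simpa only [map_mul] using! RingQuot.mkAlgHom_rel ℂ (FRel.lam_mu (θ := θ) f g)

theorem lMom_tGen (f : Mer n) (i j : Fin n) :
    lMom θ n f * tGen θ i j = tGen θ i j * lMom θ n (Mer.shift (wt i) f) := by
  simpa only [map_mul] using! RingQuot.mkAlgHom_rel ℂ (FRel.lam_t (θ := θ) f i j)

theorem rMom_tGen (f : Mer n) (i j : Fin n) :
    rMom θ n f * tGen θ i j = tGen θ i j * rMom θ n (Mer.shift (wt j) f) := by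
  simpa only [map_mul] using! RingQuot.mkAlgHom_rel ℂ (FRel.mu_t (θ := θ) f i j)

theorem one_mem_piece : (1 : FAlg θ n) ∈ FAlg.piece θ 0 0 :=
  one_mem_gradedPiece (fGen θ) FGen.deg

theorem lMom_mem_piece (f : Mer n) : lMom θ n f ∈ FAlg.piece θ 0 0 :=
  gen_mem_gradedPiece (fGen θ) FGen.deg (.lam f)

theorem rMom_mem_piece (f : Mer n) : rMom θ n f ∈ FAlg.piece θ 0 0 :=
  gen_mem_gradedPiece (fGen θ) FGen.deg (.mu f)

theorem tGen_mem_piece (i j : Fin n) : tGen θ i j ∈ FAlg.piece θ (wt i) (wt j) :=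
  gen_mem_gradedPiece (fGen θ) FGen.deg (.t i j)

theorem mul_mem_piece {α β α' β' : Fin n → ℂ} {a a' : FAlg θ n} (h : a ∈ FAlg.piece θ α β)
    (h' : a' ∈ FAlg.piece θ α' β') : a * a' ∈ FAlg.piece θ (α + α') (β + β') := by
  rw [FAlg.piece, ← Prod.mk_add_mk]
  exact mul_mem_gradedPiece h h'

theorem lMom_mul_of_mem {α β : Fin n → ℂ} {a : FAlg θ n} (ha : a ∈ FAlg.piece θ α β) (f : Mer n) :
    lMom θ n f * a = a * lMom θ n (Mer.shift α f) := by
  refine gradedPiece_comm (D := (Fin n → ℂ) × (Fin n → ℂ)) (lMom θ n)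
    (fun d => Mer.shift d.1) Mer.shift_zero
    (fun d e => Mer.shift_add d.1 e.1) (fun f s => ?_) ha f
  cases s with
  | lam g =>
    change lMom θ n f * lMom θ n g = lMom θ n g * lMom θ n (Mer.shift 0 f)
    rw [Mer.shift_zero, ← map_mul, mul_comm, map_mul]
  | mu g =>
    change lMom θ n f * rMom θ n g = rMom θ n g * lMom θ n (Mer.shift 0 f)
    rw [Mer.shift_zero, lMom_comm_rMom]
  | t i j => exact lMom_tGen f i j

theorem rMom_mul_of_mem {α β : Fin n → ℂ} {a : FAlg θ n} (ha : a ∈ FAlg.piece θ α β) (f : Mer n) :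
    rMom θ n f * a = a * rMom θ n (Mer.shift β f) := by
  refine gradedPiece_comm (D := (Fin n → ℂ) × (Fin n → ℂ)) (rMom θ n)
    (fun d => Mer.shift d.2) Mer.shift_zero
    (fun d e => Mer.shift_add d.2 e.2) (fun f s => ?_) ha f
  cases s with
  | lam g =>
    change rMom θ n f * lMom θ n g = lMom θ n g * rMom θ n (Mer.shift 0 f)
    rw [Mer.shift_zero, lMom_comm_rMom]
  | mu g =>
    change rMom θ n f * rMom θ n g = rMom θ n g * rMom θ n (Mer.shift 0 f)
    rw [Mer.shift_zero, ← map_mul, mul_comm, map_mul]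
  | t i j => exact rMom_tGen f i j

theorem gradedOver_lMom : GradedOver (lMom θ n) fun α => {a | ∃ β, a ∈ FAlg.piece θ α β} where
  one_mem := ⟨0, one_mem_piece⟩
  mul_mem := fun ⟨β, h⟩ ⟨β', h'⟩ => ⟨β + β', mul_mem_piece h h'⟩
  fn_mem f := ⟨0, lMom_mem_piece f⟩
  comm := fun ⟨_, ha⟩ f => lMom_mul_of_mem ha f

theorem gradedOver_rMom : GradedOver (rMom θ n) fun β => {a | ∃ α, a ∈ FAlg.piece θ α β} where
  one_mem := ⟨0, one_mem_piece⟩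
  mul_mem := fun ⟨β, h⟩ ⟨β', h'⟩ => ⟨β + β', mul_mem_piece h h'⟩
  fn_mem f := ⟨0, rMom_mem_piece f⟩
  comm := fun ⟨_, ha⟩ f => rMom_mul_of_mem ha f

/-- The diagonal coefficient of `u_x ⊗ u_y` in `R(λ)(u_x ⊗ u_y)`. -/
noncomputable def diagCoeff (θ : ℂ) {n : ℕ} (x y : Fin n) : Mer n :=
  if x = y then qConst θ n else if x < y then 1 else gFun θ x y

/-- The R-matrix preserves weights, so R^{xy}_{ac} vanishes unless (x, y) is (a, c) or (c, a). At
most two terms survive on each side. -/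
theorem rll_expanded (a b c d : Fin n) :
    lMom θ n (diagCoeff θ a c) * (tGen θ a b * tGen θ c d) +
      (if a = c then 0 else lMom θ n (h0Fun θ c a) * (tGen θ c b * tGen θ a d)) =
    rMom θ n (diagCoeff θ b d) * (tGen θ c d * tGen θ a b) +
      (if b = d then 0 else rMom θ n (h0Fun θ b d) * (tGen θ c b * tGen θ a d)) := by
  have h := RingQuot.mkAlgHom_rel ℂ (FRel.rll (θ := θ) a b c d)
  simp only [map_sum, map_mul] at h
  change ∑ x, ∑ y, lMom θ n (RMat θ x y a c) * tGen θ x b * tGen θ y d =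
    ∑ x, ∑ y, rMom θ n (RMat θ b d x y) * tGen θ c y * tGen θ a x at h
  have e1 : ∀ x y, lMom θ n (RMat θ x y a c) * tGen θ x b * tGen θ y d =
      (if a = x then if c = y then lMom θ n (diagCoeff θ a c) * (tGen θ a b * tGen θ c d) else 0
        else 0) +
      (if c = x then if a = y then if a = c then 0 else
        lMom θ n (h0Fun θ c a) * (tGen θ c b * tGen θ a d) else 0 else 0) := by
    intro x y
    rw [RMat, map_add, add_mul, add_mul]
    congr 1
    · by_cases h1 : a = x <;> by_cases h2 : c = y <;> simp [h1, h2, diagCoeff, mul_assoc]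
    · by_cases h1 : c = x <;> by_cases h2 : a = y
      · subst h1 h2
        by_cases h3 : a = c
        · simp [h3]
        · simp [h3, Ne.symm h3, mul_assoc]
      all_goals simp [h1, h2]
  have e2 : ∀ x y, rMom θ n (RMat θ b d x y) * tGen θ c y * tGen θ a x =
      (if b = x then if d = y then rMom θ n (diagCoeff θ b d) * (tGen θ c d * tGen θ a b) else 0
        else 0) +
      (if d = x then if b = y then if b = d then 0 else
        rMom θ n (h0Fun θ b d) * (tGen θ c b * tGen θ a d) else 0 else 0) := by
    intro x y
    rw [RMat, map_add, add_mul, add_mul]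
    congr 1
    · by_cases h1 : b = x <;> by_cases h2 : d = y
      · subst h1 h2
        simp [diagCoeff, mul_assoc]
      all_goals simp [h1, h2, eq_comm]
    · by_cases h1 : d = x <;> by_cases h2 : b = y
      · subst h1 h2
        by_cases h3 : b = d
        · simp [h3]
        · simp [h3, mul_assoc]
      all_goals simp [h1, h2, eq_comm]
  simp only [e1, e2, Finset.sum_add_distrib] at h
  simpa [Finset.sum_ite_irrel] using h

theorem lMom_qConst : lMom θ n (qConst θ n) = rMom θ n (qConst θ n) :=
  ((lMom θ n).commutes _).trans ((rMom θ n).commutes _).symm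

/-- How the two mixed quadratic relations combine. -/
theorem mixed_relation {A : Type*} [Ring A] {q H p p' X Y Z U : A} (hp : p * H = H * p)
    (h1 : X + (q - H) * Y = p * p' * U + (q - p) * Y)
    (h2 : Z + (q - H) * U = Y + (q - p') * U) :
    X + p * Z = H * (Y + p * U) := by
  -- In h1 + p · h2 the terms p p' U, q Y and p q U cancel.
  rw [eq_sub_of_add_eq h1, eq_sub_of_add_eq h2]
  have : H * (p * U) = p * (H * U) := by rw [← mul_assoc, ← mul_assoc, hp]
  simp only [mul_add, mul_sub, sub_mul, mul_assoc, this]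
  abel

/-- The key substitutions are h₀ = q - h and g(z) = h(z) h(-z). For `sq`, the RLL relation with
equal column indices has a term q t_ci t_ai on both sides, which cancels. For `anti`, the RLL
relations with columns (j, i) and (i, j) are combined by `mixed_relation`, with H = h(λ_c - λ_a), p
= h(μ_j - μ_i) and p' = h(μ_i - μ_j). -/
theorem exteriorCoaction_W (hθ : Fin n → Complex.exp θ ^ 2 ≠ 1) :
    ExteriorCoaction θ (fun i k : Fin n => i < k) (wFn θ n) (lMom θ n)
    (rMom θ n) (fun α => (WAlg.piece θ α : Set (WAlg θ n)))
    (fun α => {a | ∃ β, a ∈ FAlg.piece θ α β}) (fun i => wGen θ (.e i)) (fun j i => tGen θ j i) where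
  exterior := isExterior_W θ n
  gen_mem i := gen_mem_gradedPiece (wGen θ) EGen.deg (.e i)
  coeff_mem j i := ⟨wt i, tGen_mem_piece j i⟩
  nu_mem f := ⟨0, rMom_mem_piece f⟩
  nu_comm f j i := rMom_tGen f j i
  sq a c i hac := by
    have h := rll_expanded (θ := θ) a i c i
    rw [if_neg hac.ne, if_pos rfl, diagCoeff, if_neg hac.ne, if_pos hac, diagCoeff, if_pos rfl,
      h0Fun_eq (hθ a) hac.ne', map_one, one_mul, add_zero, map_sub, sub_mul, lMom_qConst] at h
    rw [← add_sub_assoc, sub_eq_iff_eq_add, add_comm] at h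
    exact add_left_cancel h
  anti a c i j hij hac := by
    have h1 := rll_expanded (θ := θ) a j c i
    have h2 := rll_expanded (θ := θ) a i c j
    simp only [diagCoeff, hac, hac.ne, hij, hij.ne, hij.ne', hij.not_gt, if_true, if_false, map_one,
      one_mul, gFun_eq, map_mul, h0Fun_eq (hθ a) hac.ne', h0Fun_eq (hθ a) hij.ne,
      h0Fun_eq (hθ a) hij.ne', map_sub, lMom_qConst] at h1 h2
    exact mixed_relation (lMom_comm_rMom _ _).symm h1 h2

/-- This is the mirror image of the case of W: rows and columns, λ and μ, and the two sides of the
RLL relation are exchanged, and the order is reversed. -/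
theorem exteriorCoaction_V (hθ : Fin n → Complex.exp θ ^ 2 ≠ 1) :
    ExteriorCoaction θ (fun i k : Fin n => i > k) (vFn θ n) (rMom θ n)
    (lMom θ n) (fun α => (VAlg.piece θ α : Set (VAlg θ n)))
    (fun β => {a | ∃ α, a ∈ FAlg.piece θ α β}) (fun i => vGen θ (.e i)) (fun j i => tGen θ i j) where
  exterior := isExterior_V θ n
  gen_mem i := gen_mem_gradedPiece (vGen θ) EGen.deg (.e i)
  coeff_mem j i := ⟨wt i, tGen_mem_piece i j⟩
  nu_mem f := ⟨0, lMom_mem_piece f⟩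
  nu_comm f j i := lMom_tGen f i j
  sq a c i hac := by
    have h := rll_expanded (θ := θ) i c i a
    have hne : c ≠ a := ne_of_lt hac
    rw [if_neg hne, if_pos rfl, diagCoeff, if_pos rfl, diagCoeff, if_neg hne, if_pos hac,
      h0Fun_eq (hθ a) hne, map_one, one_mul, add_zero, map_sub, sub_mul, lMom_qConst] at h
    rw [← add_sub_assoc, eq_sub_iff_add_eq, add_comm] at h
    exact (add_right_cancel h).symm
  anti a c i j hij hac := by
    have h1 := rll_expanded (θ := θ) i c j a
    have h2 := rll_expanded (θ := θ) j c i a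
    have hac' : c < a := hac
    have hij' : j < i := hij
    simp only [diagCoeff, hac', hac'.ne, hij', hij'.ne, hij'.ne', hij'.not_gt, if_true, if_false,
      map_one, one_mul, gFun_eq, map_mul, h0Fun_eq (hθ a) hac'.ne, h0Fun_eq (hθ a) hij'.ne,
      h0Fun_eq (hθ a) hij'.ne', map_sub, lMom_qConst] at h1 h2
    refine mixed_relation (lMom_comm_rMom _ _) (h1.symm.trans ?_) h2.symm
    -- `gFun_eq` yields the factors as p' p, while `mixed_relation` asks for p p'.
    rw [← map_mul, ← map_mul, mul_comm]

end FRST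

/-! ### The two tensor products as dynamical tensor products -/

section Tensor

variable (θ : ℂ) (n : ℕ)

theorem dynTensor_W : DynTensor (T := WAlg θ n ⊗[ℂ] FAlg θ n) (P := WFPre θ n) (wFn θ n) (lMom θ n) (fun α => (WAlg.piece θ α : Set (WAlg θ n)))
    (fun α => {a | ∃ β, a ∈ FAlg.piece θ α β}) (TensorProduct.mk ℂ (WAlg θ n) (FAlg θ n))
    (r := WFRel θ n) where
  gradedE := gradedOver_W
  gradedF := gradedOver_lMom
  tmul_mul e a e' a' := Algebra.TensorProduct.tmul_mul_tmul ..
  tmul_one := rfl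
  lift b := ⟨TensorProduct.lift b, fun e a => TensorProduct.lift.tmul e a⟩
  eq_adjoin := by
    rw [WFPre]
    congr 1
    ext x
    constructor
    · rintro ⟨α, β, e, a, he, ha, rfl⟩
      exact ⟨α, e, a, he, ⟨β, ha⟩, rfl⟩
    · rintro ⟨α, e, a, he, ⟨β, ha⟩, rfl⟩
      exact ⟨α, β, e, a, he, ha, rfl⟩
  rel := by
    rintro x y ⟨α, β, f, e, a, he, ha, hx, hy⟩
    exact ⟨α, f, e, a, he, ⟨β, ha⟩, .inl ⟨hx, hy⟩⟩
  rel' := by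
    rintro α f e a he ⟨β, ha⟩ x y hx hy
    exact .inl ⟨α, β, f, e, a, he, ha, hx, hy⟩

/-- The exterior algebra is now the right tensor factor. Hence the flipped pairing, and hence the
relations in the opposite direction, which is the second alternative in `DynTensor.rel`. -/
theorem dynTensor_V : DynTensor (T := FAlg θ n ⊗[ℂ] VAlg θ n) (P := FVPre θ n) (vFn θ n) (rMom θ n) (fun α => (VAlg.piece θ α : Set (VAlg θ n)))
    (fun β => {a | ∃ α, a ∈ FAlg.piece θ α β}) (TensorProduct.mk ℂ (FAlg θ n) (VAlg θ n)).flip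
    (r := FVRel θ n) where
  gradedE := gradedOver_V
  gradedF := gradedOver_rMom
  tmul_mul e a e' a' := Algebra.TensorProduct.tmul_mul_tmul ..
  tmul_one := rfl
  lift b := ⟨TensorProduct.lift b.flip, fun e a => TensorProduct.lift.tmul a e⟩
  eq_adjoin := by
    rw [FVPre]
    congr 1
    ext x
    constructor
    · rintro ⟨α, β, a, e, ha, he, rfl⟩
      exact ⟨β, e, a, he, ⟨α, ha⟩, rfl⟩
    · rintro ⟨β, e, a, he, ⟨α, ha⟩, rfl⟩
      exact ⟨α, β, a, e, ha, he, rfl⟩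
  rel := by
    rintro x y ⟨α, β, f, a, e, ha, he, hx, hy⟩
    exact ⟨β, f, e, a, he, ⟨α, ha⟩, .inr ⟨hy, hx⟩⟩
  rel' := by
    rintro β f e a he ⟨α, ha⟩ x y hx hy
    exact .inr ⟨α, β, f, a, e, ha, he, hy, hx⟩

end Tensor

/-! ### Corepresentations, minors and their equality -/

section Main

variable {θ : ℂ} {n : ℕ}

theorem sort_pairwise (I : Finset (Fin n)) :
    I.sort.Pairwise (fun i k => i < k) ∧ I.sort.toFinset = I :=
  ⟨I.sortedLT_sort.pairwise, I.sort_toFinset _⟩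

theorem sort_reverse_pairwise (I : Finset (Fin n)) :
    I.sort.reverse.Pairwise (fun i k => i > k) ∧ I.sort.reverse.toFinset = I :=
  ⟨List.pairwise_reverse.2 I.sortedLT_sort.pairwise, by
    rw [List.toFinset_reverse, I.sort_toFinset]⟩

theorem exists_coeff_W (I : Finset (Fin n)) :
    ∃ c : WAlg θ n →ₗ[ℂ] Mer n, (∀ f e, c (wFn θ n f * e) = f * c e) ∧
      ∀ p : List (Fin n), c (p.map fun i => wGen θ (.e i)).prod =
        if p.toFinset = I then listCoeff θ (fun i k => i < k) p else 0 :=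
  exists_coeff (isExterior_genRep θ _ isStrictTotal_lt.asymm).exists_lift_W I

theorem exists_coeff_V (I : Finset (Fin n)) :
    ∃ c : VAlg θ n →ₗ[ℂ] Mer n, (∀ f e, c (vFn θ n f * e) = f * c e) ∧
      ∀ p : List (Fin n), c (p.map fun i => vGen θ (.e i)).prod =
        if p.toFinset = I then listCoeff θ (fun i k => i > k) p else 0 :=
  exists_coeff (isExterior_genRep θ _ isStrictTotal_gt.asymm).exists_lift_V I

theorem exists_hom_W {F T : Type*} [Ring F] [Algebra ℂ F] [Ring T]
    [Algebra ℂ T] {μ ν : Mer n →ₐ[ℂ] F} {PE : (Fin n → ℂ) → Set (WAlg θ n)}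
    {PF : (Fin n → ℂ) → Set F} {τ : WAlg θ n →ₗ[ℂ] F →ₗ[ℂ] T} {P : Subalgebra ℂ T} {r : P → P → Prop}
    {t : Fin n → Fin n → F}
    (C : ExteriorCoaction θ (fun i k => i < k) (wFn θ n) μ ν PE PF (fun i => wGen θ (.e i)) t)
    (H : DynTensor (wFn θ n) μ PE PF τ P r) :
    ∃ R : WAlg θ n →ₐ[ℂ] (ringConGen r).Quotient,
      (∀ f, Represents (R (wFn θ n f)) (τ 1 (ν f))) ∧
      ∀ i, Represents (R (wGen θ (.e i))) (∑ j, τ (wGen θ (.e j)) (t j i)) := by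
  obtain ⟨ψ, Y, hY, h1, h2⟩ := C.exists_isExterior H isStrictTotal_lt
  obtain ⟨R, h3, h4⟩ := hY.exists_lift_W
  refine ⟨R, fun f => ?_, fun i => ?_⟩
  · rw [h3]
    exact h1 f
  · rw [h4]
    exact h2 i

theorem exists_hom_V {F T : Type*} [Ring F] [Algebra ℂ F] [Ring T]
    [Algebra ℂ T] {μ ν : Mer n →ₐ[ℂ] F} {PE : (Fin n → ℂ) → Set (VAlg θ n)}
    {PF : (Fin n → ℂ) → Set F} {τ : VAlg θ n →ₗ[ℂ] F →ₗ[ℂ] T} {P : Subalgebra ℂ T} {r : P → P → Prop}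
    {t : Fin n → Fin n → F}
    (C : ExteriorCoaction θ (fun i k => i > k) (vFn θ n) μ ν PE PF (fun i => vGen θ (.e i)) t)
    (H : DynTensor (vFn θ n) μ PE PF τ P r) :
    ∃ R : VAlg θ n →ₐ[ℂ] (ringConGen r).Quotient,
      (∀ f, Represents (R (vFn θ n f)) (τ 1 (ν f))) ∧
      ∀ i, Represents (R (vGen θ (.e i))) (∑ j, τ (vGen θ (.e j)) (t j i)) := by
  obtain ⟨ψ, Y, hY, h1, h2⟩ := C.exists_isExterior H isStrictTotal_gt
  obtain ⟨R, h3, h4⟩ := hY.exists_lift_V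
  refine ⟨R, fun f => ?_, fun i => ?_⟩
  · rw [h3]
    exact h1 f
  · rw [h4]
    exact h2 i

theorem WF.IsRep.unique {z z' : WF θ n} {x : WAlg θ n ⊗[ℂ] FAlg θ n} (h : z.IsRep x)
    (h' : z'.IsRep x) : z = z' := by
  obtain ⟨p, rfl, rfl⟩ := h
  obtain ⟨p', h, rfl⟩ := h'
  rw [Subtype.ext h]

theorem FV.IsRep.unique {z z' : FV θ n} {x : FAlg θ n ⊗[ℂ] VAlg θ n} (h : z.IsRep x)
    (h' : z'.IsRep x) : z = z' := by
  obtain ⟨p, rfl, rfl⟩ := h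
  obtain ⟨p', h, rfl⟩ := h'
  rw [Subtype.ext h]

theorem existsUnique_isRightExterior (hθ : Fin n → Complex.exp θ ^ 2 ≠ 1) :
    ∃! R : WAlg θ n →ₐ[ℂ] WF θ n, IsRightExterior R := by
  obtain ⟨R, h1, h2⟩ := exists_hom_W (exteriorCoaction_W hθ) (dynTensor_W θ n)
  have hR : IsRightExterior R := ⟨h1, h2⟩
  refine ⟨R, hR, fun R' hR' => hom_ext_W fun s => ?_⟩
  cases s with
  | fn f => exact (hR'.1 f).unique (hR.1 f)
  | e i => exact (hR'.2 i).unique (hR.2 i)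

theorem existsUnique_isLeftExterior (hθ : Fin n → Complex.exp θ ^ 2 ≠ 1) :
    ∃! L : VAlg θ n →ₐ[ℂ] FV θ n, IsLeftExterior L := by
  obtain ⟨L, h1, h2⟩ := exists_hom_V (exteriorCoaction_V hθ) (dynTensor_V θ n)
  have hL : IsLeftExterior L := ⟨h1, h2⟩
  refine ⟨L, hL, fun L' hL' => hom_ext_V fun s => ?_⟩
  cases s with
  | fn f => exact (hL'.1 f).unique (hL.1 f)
  | e i => exact (hL'.2 i).unique (hL.2 i)

theorem rightMinor_eq (hθ : Fin n → Complex.exp θ ^ 2 ≠ 1) {R : WAlg θ n →ₐ[ℂ] WF θ n}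
    (hR : IsRightExterior R) {ξ : Finset (Fin n) → Finset (Fin n) → FAlg θ n}
    (hξ : IsRightMinors R ξ) {I : Finset (Fin n)} {l : List (Fin n)}
    (hI : I.card = l.toFinset.card) :
    minor θ (fun i k => i < k) (lMom θ n) (fun j i => tGen θ j i) I l =
      rMom θ n (listCoeff θ (fun i k => i < k) l) * ξ I l.toFinset :=
  (exteriorCoaction_W hθ).minor_eq (dynTensor_W θ n) isStrictTotal_lt (fun I : Finset (Fin n) => I.sort (fun a b => a ≤ b))
    sort_pairwise exists_coeff_W hR.1 hR.2 (ξ := fun K => ξ K l.toFinset) (J := l.toFinset) (hξ.2 _) hI rfl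

theorem leftMinor_eq (hθ : Fin n → Complex.exp θ ^ 2 ≠ 1) {L : VAlg θ n →ₐ[ℂ] FV θ n}
    (hL : IsLeftExterior L) {η : Finset (Fin n) → Finset (Fin n) → FAlg θ n}
    (hη : IsLeftMinors L η) {J : Finset (Fin n)} {l : List (Fin n)}
    (hJ : J.card = l.toFinset.card) :
    minor θ (fun i k => i > k) (rMom θ n) (fun j i => tGen θ i j) J l =
      lMom θ n (listCoeff θ (fun i k => i > k) l) * η l.toFinset J :=
  (exteriorCoaction_V hθ).minor_eq (dynTensor_V θ n) isStrictTotal_gt (fun I : Finset (Fin n) => (I.sort (fun a b => a ≤ b)).reverse)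
    sort_reverse_pairwise exists_coeff_V hL.1 hL.2 (ξ := fun K => η l.toFinset K) (J := l.toFinset) (hη.2 _) hJ rfl

/-- The sorted arrangement of J has coefficient 1, so `rightMinor_eq` determines ξ^I_J as an
explicit sum; by `represents_minor` that sum does satisfy the defining equation. -/
theorem existsUnique_isRightMinors (hθ : Fin n → Complex.exp θ ^ 2 ≠ 1)
    {R : WAlg θ n →ₐ[ℂ] WF θ n} (hR : IsRightExterior R) :
    ∃! ξ : Finset (Fin n) → Finset (Fin n) → FAlg θ n, IsRightMinors R ξ := by
  have huniq : ∀ ξ : Finset (Fin n) → Finset (Fin n) → FAlg θ n, IsRightMinors R ξ →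
      ξ = fun I J => if I.card = J.card then
        minor θ (fun i k => i < k) (lMom θ n) (fun j i => tGen θ j i) I J.sort else 0 := by
    intro ξ hξ
    funext I J
    split_ifs with h
    · have hJ := (sort_pairwise J).2
      have := rightMinor_eq hθ hR hξ (I := I) (l := J.sort) (by rw [hJ, h])
      rw [this, listCoeff_of_pairwise isStrictTotal_lt.asymm (sort_pairwise J).1, map_one,
        one_mul, hJ]
    · exact hξ.1 I J h
  refine ⟨_, ⟨fun I J h => if_neg h, fun J => ?_⟩, huniq⟩
  have h := (exteriorCoaction_W hθ).represents_minor (dynTensor_W θ n) isStrictTotal_lt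
    (fun I : Finset (Fin n) => I.sort (fun a b => a ≤ b)) sort_pairwise hR.2 J.sort
  rw [Finset.length_sort] at h
  have e : ∑ I with I.card = J.card, wSet θ I ⊗ₜ[ℂ] (if I.card = J.card then
      minor θ (fun i k => i < k) (lMom θ n) (fun j i => tGen θ j i) I J.sort else 0) =
      ∑ I with I.card = J.card, wSet θ I ⊗ₜ[ℂ]
        minor θ (fun i k => i < k) (lMom θ n) (fun j i => tGen θ j i) I J.sort :=
    Finset.sum_congr rfl fun I hI => by rw [if_pos (Finset.mem_filter_univ _ |>.1 hI)]
  rw [e]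
  exact h

theorem existsUnique_isLeftMinors (hθ : Fin n → Complex.exp θ ^ 2 ≠ 1)
    {L : VAlg θ n →ₐ[ℂ] FV θ n} (hL : IsLeftExterior L) :
    ∃! η : Finset (Fin n) → Finset (Fin n) → FAlg θ n, IsLeftMinors L η := by
  have huniq : ∀ η : Finset (Fin n) → Finset (Fin n) → FAlg θ n, IsLeftMinors L η →
      η = fun I J => if I.card = J.card then
        minor θ (fun i k => i > k) (rMom θ n) (fun j i => tGen θ i j) J I.sort.reverse else 0 := by
    intro η hη
    funext I J
    split_ifs with h
    · have hI := (sort_reverse_pairwise I).2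
      have := leftMinor_eq hθ hL hη (J := J) (l := I.sort.reverse) (by rw [hI, h])
      rw [this, listCoeff_of_pairwise isStrictTotal_gt.asymm (sort_reverse_pairwise I).1, map_one,
        one_mul, hI]
    · exact hη.1 I J h
  refine ⟨_, ⟨fun I J h => if_neg h, fun I => ?_⟩, huniq⟩
  have h := (exteriorCoaction_V hθ).represents_minor (dynTensor_V θ n) isStrictTotal_gt
    (fun I : Finset (Fin n) => (I.sort (fun a b => a ≤ b)).reverse) sort_reverse_pairwise hL.2 I.sort.reverse
  rw [List.length_reverse, Finset.length_sort] at h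
  have e : ∑ J with J.card = I.card, (if I.card = J.card then
      minor θ (fun i k => i > k) (rMom θ n) (fun j i => tGen θ i j) J I.sort.reverse else 0)
        ⊗ₜ[ℂ] vSet θ J =
      ∑ J with J.card = I.card,
        minor θ (fun i k => i > k) (rMom θ n) (fun j i => tGen θ i j) J I.sort.reverse
          ⊗ₜ[ℂ] vSet θ J :=
    Finset.sum_congr rfl fun J hJ => by rw [if_pos (Finset.mem_filter_univ _ |>.1 hJ).symm]
  rw [e]
  exact h

/-- Both families of matrix elements are obtained from the same sum over all arrangements of the
rows and of the columns. -/
theorem rightMinors_eq_leftMinors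
    (hq : ∀ k : ℕ, 1 ≤ k → k ≤ n → Complex.exp θ ^ (2 * k) ≠ 1)
    (hθ : Fin n → Complex.exp θ ^ 2 ≠ 1) {R : WAlg θ n →ₐ[ℂ] WF θ n} {L : VAlg θ n →ₐ[ℂ] FV θ n}
    (hR : IsRightExterior R) (hL : IsLeftExterior L)
    {ξ η : Finset (Fin n) → Finset (Fin n) → FAlg θ n} (hξ : IsRightMinors R ξ)
    (hη : IsLeftMinors L η) (I J : Finset (Fin n)) : ξ I J = η I J := by
  by_cases h : I.card = J.card
  swap
  · rw [hξ.1 I J h, hη.1 I J h]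
  have hc : arrangementConst θ J.card ≠ 0 :=
    arrangementConst_ne_zero fun k hk hk' => hq k hk (hk'.trans (by simpa using J.card_le_univ))
  -- The equation for the arrangement ρ carries the factor c_<(ρ)(μ). Weighting it with c_>(ρ)(μ)
  -- turns the sum of the factors into the constant of `sum_listCoeff_mul`; the left minors are
  -- weighted with c_< correspondingly.
  have h1 : ∑ ρ ∈ words (Fin n) J.card with ρ.toFinset = J,
      rMom θ n (listCoeff θ (fun i k => i > k) ρ) *
        minor θ (fun i k => i < k) (lMom θ n) (fun j i => tGen θ j i) I ρ =
      arrangementConst θ J.card • ξ I J := by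
    rw [Algebra.smul_def, ← (rMom θ n).commutes, ← sum_listCoeff_mul hθ J, map_sum,
      Finset.sum_mul]
    refine Finset.sum_congr rfl fun ρ hρ => ?_
    obtain ⟨-, rfl⟩ := Finset.mem_filter.1 hρ
    rw [rightMinor_eq hθ hR hξ h, ← mul_assoc, ← map_mul, mul_comm (listCoeff _ _ _)]
  have h2 : ∑ σ ∈ words (Fin n) I.card with σ.toFinset = I,
      lMom θ n (listCoeff θ (fun i k => i < k) σ) *
        minor θ (fun i k => i > k) (rMom θ n) (fun j i => tGen θ i j) J σ =
      arrangementConst θ I.card • η I J := by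
    rw [Algebra.smul_def, ← (lMom θ n).commutes, ← sum_listCoeff_mul hθ I, map_sum,
      Finset.sum_mul]
    refine Finset.sum_congr rfl fun σ hσ => ?_
    obtain ⟨-, rfl⟩ := Finset.mem_filter.1 hσ
    rw [leftMinor_eq hθ hL hη h.symm, ← mul_assoc, ← map_mul]
  -- Both sides are the sum over all σ and ρ of c_<(σ)(λ) c_>(ρ)(μ) ∏ t_{σ_k ρ_k}.
  have h3 : ∑ ρ ∈ words (Fin n) J.card with ρ.toFinset = J,
      rMom θ n (listCoeff θ (fun i k => i > k) ρ) *
        minor θ (fun i k => i < k) (lMom θ n) (fun j i => tGen θ j i) I ρ =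
      ∑ σ ∈ words (Fin n) I.card with σ.toFinset = I,
      lMom θ n (listCoeff θ (fun i k => i < k) σ) *
        minor θ (fun i k => i > k) (rMom θ n) (fun j i => tGen θ i j) J σ := by
    have e1 : ∀ ρ ∈ words (Fin n) J.card, ∀ x : FAlg θ n,
        x * minor θ (fun i k => i < k) (lMom θ n) (fun j i => tGen θ j i) I ρ =
        ∑ σ ∈ words (Fin n) I.card with σ.toFinset = I,
          x * (lMom θ n (listCoeff θ (fun i k => i < k) σ) * wordProd (tGen θ) σ ρ) :=
      fun ρ hρ x => by rw [minor, length_of_mem_words hρ, h, Finset.mul_sum]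
    have e2 : ∀ σ ∈ words (Fin n) I.card, ∀ x : FAlg θ n,
        x * minor θ (fun i k => i > k) (rMom θ n) (fun j i => tGen θ i j) J σ =
        ∑ ρ ∈ words (Fin n) J.card with ρ.toFinset = J,
          x * (rMom θ n (listCoeff θ (fun i k => i > k) ρ) * wordProd (tGen θ) σ ρ) :=
      fun σ hσ x => by
        rw [minor, length_of_mem_words hσ, h, Finset.mul_sum]
        simp only [wordProd_swap]
    rw [Finset.sum_congr rfl fun ρ hρ => e1 ρ (Finset.mem_filter.1 hρ).1 _,
      Finset.sum_congr rfl fun σ hσ => e2 σ (Finset.mem_filter.1 hσ).1 _, Finset.sum_comm]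
    refine Finset.sum_congr rfl fun σ _ => Finset.sum_congr rfl fun ρ _ => ?_
    rw [← mul_assoc, ← mul_assoc, lMom_comm_rMom]
  rw [h1, h2, h] at h3
  exact smul_right_injective _ hc h3

end Main

end DynU

open DynU in
theorem theorem3p10 (n : ℕ) (θ : ℂ)
    (hq : ∀ k : ℕ, 1 ≤ k → k ≤ n → Complex.exp θ ^ (2 * k) ≠ 1) :
    (∃! R : WAlg θ n →ₐ[ℂ] WF θ n, IsRightExterior R) ∧
    (∃! L : VAlg θ n →ₐ[ℂ] FV θ n, IsLeftExterior L) ∧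
    ∀ (R : WAlg θ n →ₐ[ℂ] WF θ n) (L : VAlg θ n →ₐ[ℂ] FV θ n),
      IsRightExterior R → IsLeftExterior L →
      (∃! ξ : Finset (Fin n) → Finset (Fin n) → FAlg θ n, IsRightMinors R ξ) ∧
      (∃! η : Finset (Fin n) → Finset (Fin n) → FAlg θ n, IsLeftMinors L η) ∧
      ∀ ξ η : Finset (Fin n) → Finset (Fin n) → FAlg θ n,
        IsRightMinors R ξ → IsLeftMinors L η →
        (∀ I J : Finset (Fin n), ξ I J = η I J) ∧
          ξ Finset.univ Finset.univ = η Finset.univ Finset.univ := by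
  -- For n = 0 the assumption on q is empty; q² ≠ 1 follows only once an index exists.
  have hθ : Fin n → Complex.exp θ ^ 2 ≠ 1 := fun i => by
    simpa using hq 1 le_rfl (by have := i.2; lia)
  refine ⟨existsUnique_isRightExterior hθ, existsUnique_isLeftExterior hθ, fun R L hR hL =>
    ⟨existsUnique_isRightMinors hθ hR, existsUnique_isLeftMinors hθ hL, fun ξ η hξ hη => ?_⟩⟩
  have h := rightMinors_eq_leftMinors hq hθ hR hL hξ hη
  exact ⟨h, h _ _⟩
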